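/- Let $D=\frac{d}{dx}$ and let $Q\colon\mathbb C[x]\to\mathbb C[x]$ be a normalized delta operator: a linear operator that reduces degrees by one (and kills constants), commutes with all shifts $f(x)\mapsto f(x+a)$, and has the form $Q=D+a_2D^2+a_3D^3+\cdots$; by this formula $Q$ also acts on $\mathbb C((x^{-1}))=\{\sum_{k\le n}a_kx^k\mid a_k\in\mathbb{C},\ n\in\mathbb{Z}\}$. Let $\{p_n(x)\}_{n\ge 0}$ be the polynomials determined by $Qp_n=n\,p_{n-1}$ and $p_n(0)=\delta_{n,0}$. Extend them to $p_n,p^*_n\in\mathbb C((x^{-1}))$ for all $n\in\mathbb Z$ by $p^*_{-1}=x^{-1}$, $Qp^*_n=n\,p^*_{n-1}$ for $n<0$, and $p_{n+1}(x)=x\,p^*_n(x)$ for all $n\in\mathbb{Z}$; for $n\ge0$ both $p_n$ and $p_n^*$ are polynomials. For a commutative ring $R$, let $R((x_1^{-1},\ldots,x_N^{-1}))$ be the ring of formal series $\sum a_{k_1,\ldots,k_N}x_1^{k_1}\cdots x_N^{k_N}$ with $a_{k_1,\ldots,k_N}\in R$, $k_i\in\mathbb Z$, and exponents bounded above in each variable.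 For $\lambda\in\mathbb Z^N$ define $s_\lambda,s^*_\lambda\in\mathbb C((x_1^{-1},\ldots,x_N^{-1}))$ as the quotients $$s_\lambda(x_1,\ldots,x_N)=\frac{\det\bigl(p_{\lambda_i+N-i}(x_j)\bigr)_{1\le i,j\le N}}{\det\bigl(p_{N-i}(x_j)\bigr)_{1\le i,j\le N}},\qquad s^*_\lambda(x_1,\ldots,x_N)=\frac{\det\bigl(p^*_{\lambda_i+N-i}(x_j)\bigr)_{1\le i,j\le N}}{\det\bigl(p^*_{N-i}(x_j)\bigr)_{1\le i,j\le N}}.$$ **Theorem.** Let $\lambda=(\lambda_1,\ldots,\lambda_N)\in\mathbb Z^N$ with $\lambda_1\ge\lambda_2\ge\cdots\ge\lambda_N$. Then $$s_\lambda(x_1+u,\ldots,x_N+u)=\sum_{\mu\subset\lambda}d_{\lambda\mu}(u)\,s_\mu(x_1,\ldots,x_N),$$ $$s^*_\lambda(x_1+u,\ldots,x_N+u)=\sum_{\mu\subset\lambda}d_{\lambda\mu}(u)\,s^*_\mu(x_1,\ldots,x_N),$$ $$s^*_\lambda(x_1+u,\ldots,x_N+u)=\sum_{\mu\subset\lambda}d^*_{\lambda\mu}(u)\,s_\mu(x_1,\ldots,x_N)$$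 as equalities in $\mathbb C[u]((x_1^{-1},\ldots,x_N^{-1}))$, where powers of $x_i+u$ are expanded as $(x_i+u)^k=\sum_{j\ge0}\binom kj u^jx_i^{k-j}$. The (in general infinite) sums run over all $\mu\in\mathbb Z^N$ with $\mu_1\ge\cdots\ge\mu_N$ and $\mu_i\le\lambda_i$ for all $i$, and are formal: the exponents occurring in the summands are bounded above uniformly in $\mu$, and each monomial in the $x_i$ occurs in only finitely many summands. Here $$d_{\lambda\mu}(u)=\det\left(\binom{\lambda_i+N-i}{\lambda_i-\mu_j-i+j}p_{\lambda_i-\mu_j-i+j}(u)\right)_{1\le i,j\le N},\qquad d^*_{\lambda\mu}(u)=\det\left(\binom{\lambda_i+N-i}{\lambda_i-\mu_j-i+j}p^*_{\lambda_i-\mu_j-i+j}(u)\right)_{1\le i,j\le N},$$ with $\binom nk=\frac{n(n-1)\cdots(n-k+1)}{k!}$ for $n\in\mathbb Z$, $k\ge0$, and with the entries with $\lambda_i-\mu_j-i+j<0$ equal to $0$. -/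

import Mathlib

open Polynomial

namespace SchurType

/-- The coefficient `a_k` of `D ^ k` in the expansion `T = ∑ a_k D ^ k` (with `D = d/dx`) of a
shift-invariant operator `T` on `ℂ[x]`; explicitly `a_k = (T x ^ k)(0) / k!`. -/
noncomputable def dCoeff (T : ℂ[X] →ₗ[ℂ] ℂ[X]) (k : ℕ) : ℂ :=
  (T (X ^ k)).eval 0 / (k.factorial : ℂ)

/-- A normalized delta operator: a linear operator on `ℂ[x]` that reduces degrees by one (and kills
constants), commutes with all shifts `f(x) ↦ f(x + a)`, and has leading term `D`. -/
structure NormalizedDeltaOperator where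
  toLin : ℂ[X] →ₗ[ℂ] ℂ[X]
  map_C : ∀ c : ℂ, toLin (C c) = 0
  degree_map : ∀ (f : ℂ[X]) (n : ℕ), f.degree = ((n + 1 : ℕ) : WithBot ℕ) →
    (toLin f).degree = (n : WithBot ℕ)
  map_shift : ∀ (a : ℂ) (f : ℂ[X]), toLin (f.comp (X + C a)) = (toLin f).comp (X + C a)
  normalized : dCoeff toLin 1 = 1

namespace NormalizedDeltaOperator

variable (Q : NormalizedDeltaOperator)

theorem exists_preimage (g : ℂ[X]) : ∃ f : ℂ[X], f.eval 0 = 0 ∧ Q.toLin f = g := by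
  suffices H : ∀ (n : ℕ) (g : ℂ[X]), g.degree < n → ∃ f : ℂ[X], f.eval 0 = 0 ∧ Q.toLin f = g by
    refine H (g.natDegree + 1) g ?_
    exact lt_of_le_of_lt degree_le_natDegree (by exact_mod_cast Nat.lt_succ_self _)
  intro n
  induction n with
  | zero =>
    intro g hg
    refine ⟨0, by simp, ?_⟩
    have : g = 0 := by
      rw [← degree_eq_bot]; exact (Nat.WithBot.lt_zero_iff).1 (by simpa using hg)
    simp [this]
  | succ n ih =>
    intro g hg
    have hd : (Q.toLin (X ^ (n + 1))).degree = (n : WithBot ℕ) :=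
      Q.degree_map _ n (by rw [degree_X_pow])
    have hne : Q.toLin (X ^ (n + 1)) ≠ 0 := by
      intro h; rw [h] at hd; simp at hd
    have hnd : (Q.toLin (X ^ (n + 1))).natDegree = n := natDegree_eq_of_degree_eq_some hd
    have hc : (Q.toLin (X ^ (n + 1))).coeff n ≠ 0 := by
      have := leadingCoeff_ne_zero.2 hne
      rwa [leadingCoeff, hnd] at this
    set c := g.coeff n / (Q.toLin (X ^ (n + 1))).coeff n with hcdef
    obtain ⟨f, hf0, hf⟩ := ih (g - c • Q.toLin (X ^ (n + 1))) (by
      rw [degree_lt_iff_coeff_zero]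
      intro m hm
      rcases hm.eq_or_lt with rfl | hm
      · simp [hcdef, hc]
      · have h1 : g.coeff m = 0 :=
          coeff_eq_zero_of_degree_lt (lt_of_lt_of_le hg (by exact_mod_cast hm))
        have h2 : (Q.toLin (X ^ (n + 1))).coeff m = 0 :=
          coeff_eq_zero_of_natDegree_lt (by omega)
        simp [h1, h2])
    refine ⟨f + c • X ^ (n + 1), by simp [hf0], ?_⟩
    rw [map_add, hf, map_smul]
    ring

/-- The polynomials `p_n`, `n ≥ 0`, associated with `Q`: the unique sequence with
`Q p_n = n p_{n-1}` and `p_n(0) = δ_{n,0}`. -/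
noncomputable def basicPoly : ℕ → ℂ[X]
  | 0 => 1
  | n + 1 => Classical.choose (Q.exists_preimage (((n : ℂ) + 1) • basicPoly n))

theorem basicPoly_zero : Q.basicPoly 0 = 1 := by rw [basicPoly]

theorem eval_basicPoly_succ (n : ℕ) : (Q.basicPoly (n + 1)).eval 0 = 0 := by
  rw [basicPoly]
  exact (Classical.choose_spec (Q.exists_preimage (((n : ℂ) + 1) • Q.basicPoly n))).1

theorem map_basicPoly_succ (n : ℕ) :
    Q.toLin (Q.basicPoly (n + 1)) = ((n : ℂ) + 1) • Q.basicPoly n := by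
  rw [basicPoly]
  exact (Classical.choose_spec (Q.exists_preimage (((n : ℂ) + 1) • Q.basicPoly n))).2

/-- The polynomials `p*_n(x) = x⁻¹ p_{n+1}(x)`, `n ≥ 0` (`p_{n+1}` has no constant term). -/
noncomputable def basicPolyStar (n : ℕ) : ℂ[X] := (Q.basicPoly (n + 1)).divX

theorem toLin_X_pow (m : ℕ) : Q.toLin (X ^ m) =
    ∑ k ∈ Finset.range (m + 1),
      C ((m.choose k : ℂ) * (Q.toLin (X ^ k)).eval 0) * X ^ (m - k) := by
  refine Polynomial.funext fun a => ?_
  have h : (Q.toLin (X ^ m)).eval a = ((Q.toLin (X ^ m)).comp (X + C a)).eval 0 := by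
    simp [eval_comp]
  rw [h, ← Q.map_shift, pow_comp, X_comp, add_pow, map_sum, eval_finsetSum, eval_finsetSum]
  refine Finset.sum_congr rfl fun k _ => ?_
  have : (X ^ k * C a ^ (m - k) * ((m.choose k : ℕ) : ℂ[X]) : ℂ[X]) =
      (a ^ (m - k) * (m.choose k : ℂ)) • X ^ k := by
    rw [smul_eq_C_mul]; simp only [C_mul, C_pow, map_natCast]; ring
  rw [this, map_smul]
  simp
  ring

theorem coeff_toLin_X_pow (n : ℕ) : (Q.toLin (X ^ (n + 1))).coeff n = (n : ℂ) + 1 := by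
  have h1 : (Q.toLin X).eval 0 = 1 := by simpa [dCoeff] using Q.normalized
  have h0 : (Q.toLin 1).eval 0 = 0 := by
    have := Q.map_C 1
    rw [C_1] at this; simp [this]
  rw [toLin_X_pow, finsetSum_coeff, Finset.sum_eq_single 1]
  · have e : ((((n + 1).choose 1 : ℕ) : ℂ) * (Q.toLin (X ^ 1)).eval 0) = (n : ℂ) + 1 := by
      simp [h1]
    rw [e, coeff_C_mul]
    simp
  · intro k hk hk1
    rw [coeff_C_mul, coeff_X_pow]
    rcases Nat.eq_zero_or_pos k with rfl | hk0
    · simp [h0]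
    · rw [if_neg (by simp at hk; omega)]; simp
  · simp

theorem basicPoly_spec (n : ℕ) : (Q.basicPoly n).natDegree = n ∧ (Q.basicPoly n).Monic := by
  induction n with
  | zero => simp [basicPoly_zero]
  | succ n ih =>
    have hQ := Q.map_basicPoly_succ n
    set f := Q.basicPoly (n + 1) with hf
    have hn : ((n : ℂ) + 1) ≠ 0 := by exact_mod_cast n.succ_ne_zero
    have hfd : f.natDegree = n + 1 := by
      rcases Nat.eq_zero_or_pos f.natDegree with h0 | hpos
      · rw [eq_C_of_natDegree_eq_zero h0, Q.map_C] at hQ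
        exact absurd hQ.symm (smul_ne_zero hn ih.2.ne_zero)
      · obtain ⟨m, hm⟩ : ∃ m, f.natDegree = m + 1 := ⟨f.natDegree - 1, by omega⟩
        have hf0 : f ≠ 0 := by rintro h; rw [h] at hm; simp at hm
        have := Q.degree_map f m (by rw [degree_eq_natDegree hf0, hm])
        rw [hQ] at this
        have h2 := natDegree_eq_of_degree_eq_some this
        rw [natDegree_smul _ hn, ih.1] at h2
        omega
    refine ⟨hfd, ?_⟩
    have hsplit : f = f.coeff (n + 1) • X ^ (n + 1) + f.eraseLead := by
      conv_lhs => rw [← eraseLead_add_C_mul_X_pow f, hfd, leadingCoeff, hfd]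
      rw [smul_eq_C_mul, add_comm]
    have hlow : (Q.toLin f.eraseLead).coeff n = 0 := by
      set g := f.eraseLead with hg
      have hgd : g.degree < (n + 1 : ℕ) := by
        have := degree_eraseLead_lt (f := f) (by rintro h; rw [h] at hfd; simp at hfd)
        rwa [degree_eq_natDegree (p := f) (by rintro h; rw [h] at hfd; simp at hfd), hfd] at this
      rcases Nat.eq_zero_or_pos g.natDegree with h0 | hpos
      · rw [eq_C_of_natDegree_eq_zero h0, Q.map_C]; simp
      · obtain ⟨m, hm⟩ : ∃ m, g.natDegree = m + 1 := ⟨g.natDegree - 1, by omega⟩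
        have hg0 : g ≠ 0 := by rintro h; rw [h] at hm; simp at hm
        have h3 := Q.degree_map g m (by rw [degree_eq_natDegree hg0, hm])
        rw [degree_eq_natDegree hg0, hm] at hgd
        refine coeff_eq_zero_of_degree_lt ?_
        rw [h3]
        have : m + 1 < n + 1 := by exact_mod_cast hgd
        exact_mod_cast (by omega : m < n)
    have hc := congrArg (fun q => q.coeff n) hQ
    beta_reduce at hc
    rw [hsplit, map_add, map_smul, coeff_add, coeff_smul, hlow, coeff_toLin_X_pow, coeff_smul,
      add_zero, smul_eq_mul, smul_eq_mul] at hc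
    have hl : (Q.basicPoly n).coeff n = 1 := by
      have := ih.2.leadingCoeff; rwa [leadingCoeff, ih.1] at this
    rw [hl, mul_comm] at hc
    rw [Monic, leadingCoeff, hfd]
    exact mul_left_cancel₀ hn hc

end NormalizedDeltaOperator

/-! `ℂ((x⁻¹))` is modelled by `LaurentSeries ℂ` and `R((x_1⁻¹, …, x_N⁻¹))` by Hahn series on
`Fin N → ℤ` with the product order.  In both cases the exponents are those of the inverse
variables: the coefficient at `m` is the coefficient of `x ^ (-m)`.  In `ℤ ^ N` the partially
well-ordered sets are the sets that are bounded below, so all supports bounded above in the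
exponents of the `x_i` are allowed, and only these. -/

/-- The derivation `D = d/dx` of `ℂ((x⁻¹))`. -/
noncomputable def derivX (f : LaurentSeries ℂ) : LaurentSeries ℂ :=
  HahnSeries.ofSuppBddBelow (fun n => ((1 - n : ℤ) : ℂ) * f.coeff (n - 1)) (by
    refine ⟨f.order + 1, fun n hn => ?_⟩
    have h : f.coeff (n - 1) ≠ 0 := right_ne_zero_of_mul hn
    have := HahnSeries.order_le_of_coeff_ne_zero h
    omega)

theorem order_le_of_coeff_derivX_iterate (f : LaurentSeries ℂ) (k : ℕ) (n : ℤ)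
    (h : (derivX^[k] f).coeff n ≠ 0) : f.order + k ≤ n := by
  induction k generalizing n with
  | zero => simpa using HahnSeries.order_le_of_coeff_ne_zero h
  | succ k ih =>
    rw [Function.iterate_succ_apply'] at h
    have h2 : (derivX^[k] f).coeff (n - 1) ≠ 0 := right_ne_zero_of_mul h
    have := ih _ h2
    push_cast
    omega

namespace NormalizedDeltaOperator

variable (Q : NormalizedDeltaOperator)

/-- The extension `∑ a_k D ^ k` of `Q` to `ℂ((x⁻¹))`; each coefficient is a finite sum. -/
noncomputable def onLaurent (f : LaurentSeries ℂ) : LaurentSeries ℂ :=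
  HahnSeries.ofSuppBddBelow
    (fun n => ∑ᶠ k : ℕ, dCoeff Q.toLin k * (derivX^[k] f).coeff n) (by
    refine ⟨f.order, fun n hn => ?_⟩
    obtain ⟨k, hk⟩ : ∃ k : ℕ, dCoeff Q.toLin k * (derivX^[k] f).coeff n ≠ 0 := by
      by_contra! h
      exact hn (by simp [h])
    have := order_le_of_coeff_derivX_iterate f k n (right_ne_zero_of_mul hk)
    omega)

/-- `negStar m` is `p*_n` for `n = -(m + 1)`: it is determined by `p*_{-1} = x⁻¹` and
`Q p*_n = n p*_{n-1}`. -/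
noncomputable def negStar : ℕ → LaurentSeries ℂ
  | 0 => HahnSeries.single 1 1
  | m + 1 => HahnSeries.C (-((m : ℂ) + 1)⁻¹) * Q.onLaurent (negStar m)

/-- The inclusion `ℂ[x] → ℂ((x⁻¹))`. -/
noncomputable def ofPoly : ℂ[X] →+* LaurentSeries ℂ :=
  Polynomial.eval₂RingHom HahnSeries.C (HahnSeries.single (-1) 1)

/-- `p_n(x) ∈ ℂ((x⁻¹))` for all `n ∈ ℤ`; for negative `n` it is `x p*_{n-1}(x)`. -/
noncomputable def p : ℤ → LaurentSeries ℂ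
  | Int.ofNat n => ofPoly (Q.basicPoly n)
  | Int.negSucc m => HahnSeries.single (-1) 1 * Q.negStar (m + 1)

/-- `p*_n(x) = x⁻¹ p_{n+1}(x) ∈ ℂ((x⁻¹))` for all `n ∈ ℤ`. -/
noncomputable def pStar (n : ℤ) : LaurentSeries ℂ := HahnSeries.single 1 1 * Q.p (n + 1)

end NormalizedDeltaOperator

/-- The ring `R((x_1⁻¹, …, x_N⁻¹))`. -/
abbrev MultiLaurent (N : ℕ) (R : Type*) [Zero R] : Type _ := HahnSeries (Fin N → ℤ) R

theorem isPWO_of_bddBelow {N : ℕ} {s : Set (Fin N → ℤ)} (h : BddBelow s) : s.IsPWO := by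
  obtain ⟨b, hb⟩ := h
  have hu : (Set.univ : Set (Fin N → ℕ)).IsPWO := Set.isPWO_of_wellQuasiOrderedLE _
  have hm : Monotone (fun (j : Fin N → ℕ) (i : Fin N) => b i + (j i : ℤ)) := by
    intro j k hjk i
    have h1 : j i ≤ k i := hjk i
    change b i + (j i : ℤ) ≤ b i + (k i : ℤ)
    omega
  refine (hu.image_of_monotone hm).mono fun m hm => ⟨fun i => (m i - b i).toNat, trivial, ?_⟩
  funext i
  have h1 : b i ≤ m i := hb hm i
  change b i + ((m i - b i).toNat : ℤ) = m i
  omega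

/-- The substitution `f(x) ↦ f(x_j)`. -/
noncomputable def atVar {N : ℕ} (j : Fin N) : LaurentSeries ℂ →+* MultiLaurent N ℂ :=
  HahnSeries.embDomainRingHom (AddMonoidHom.single (fun _ : Fin N => ℤ) j)
    (Pi.single_injective (M := fun _ : Fin N => ℤ) j)
    (fun a b => by simp)

/-- The determinant `det (f_i(x_j))`. -/
noncomputable def alternant {N : ℕ} (f : Fin N → LaurentSeries ℂ) : MultiLaurent N ℂ :=
  (Matrix.of fun i j => atVar j (f i)).det

/-- The variable `x_j`. -/
noncomputable def xVar {N : ℕ} (j : Fin N) : MultiLaurent N ℂ :=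
  HahnSeries.single (-Pi.single j 1) 1

theorem atVar_X {N : ℕ} (j : Fin N) : atVar j (HahnSeries.single (-1) 1) = xVar j := by
  refine HahnSeries.embDomain_single.trans ?_
  rw [xVar, ← Pi.single_neg]
  rfl

section DividedDifference

variable {N : ℕ}

/-- The coefficients of the divided difference of `f` at the variables `x_i`, `i ∈ S`. -/
noncomputable def ddCoeff (f : LaurentSeries ℂ) (S : Finset (Fin N)) (m : Fin N → ℤ) : ℂ :=
  if ∀ i ∉ S, m i = 0 then
    if ∀ i ∈ S, m i ≤ 0 then f.coeff (∑ i, m i - S.card + 1)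
    else if ∀ i ∈ S, 1 ≤ m i then (-1) ^ (S.card + 1) * f.coeff (∑ i, m i - S.card + 1)
    else 0
  else 0

theorem bddBelow_ddCoeff (f : LaurentSeries ℂ) (S : Finset (Fin N)) :
    BddBelow (Function.support (ddCoeff f S)) := by
  refine ⟨fun _ => min 0 (f.order + S.card - 1), fun m hm i => ?_⟩
  simp only [Function.mem_support, ddCoeff] at hm
  split_ifs at hm with h1 h2 h3
  · have h4 := HahnSeries.order_le_of_coeff_ne_zero hm
    have hle : ∀ i, m i ≤ 0 := fun i => by
      by_cases hi : i ∈ S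
      · exact h2 i hi
      · exact (h1 i hi).le
    have h5 : ∑ i, m i ≤ m i := by
      rw [← Finset.add_sum_erase _ _ (Finset.mem_univ i)]
      have : ∑ j ∈ Finset.univ.erase i, m j ≤ 0 := Finset.sum_nonpos fun j _ => hle j
      omega
    simp only
    omega
  · have : 0 ≤ m i := by
      by_cases hi : i ∈ S
      · have := h3 i hi; omega
      · exact (h1 i hi).ge
    exact (min_le_left _ _).trans this
  · exact absurd rfl hm
  · exact absurd rfl hm

/-- The divided difference of `f` at the variables `x_i`, `i ∈ S`. -/
noncomputable def dd (f : LaurentSeries ℂ) (S : Finset (Fin N)) : MultiLaurent N ℂ :=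
  ⟨ddCoeff f S, isPWO_of_bddBelow (bddBelow_ddCoeff f S)⟩

theorem dd_singleton (f : LaurentSeries ℂ) (j : Fin N) : dd f {j} = atVar j f := by
  ext m
  change ddCoeff f {j} m = _
  by_cases h : ∀ i ∉ ({j} : Finset (Fin N)), m i = 0
  · have hm : m = Pi.single j (m j) := by
      funext i
      by_cases hi : i = j
      · subst hi; simp
      · rw [h i (by simpa using hi)]; simp [hi]
    have hs : ∑ i, m i = m j := by
      rw [Finset.sum_eq_single j] <;> simp +contextual [h]
    have hr : (atVar j f).coeff m = f.coeff (m j) := by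
      conv_lhs => rw [hm]
      exact HahnSeries.embDomain_coeff
    rw [hr, ddCoeff, if_pos h, hs]
    by_cases h0 : m j ≤ 0
    · simp [h0]
    · have : 1 ≤ m j := by omega
      simp [h0, this]
  · rw [ddCoeff, if_neg h]
    symm
    refine HahnSeries.embDomain_of_notMem_range ?_
    rintro ⟨k, rfl⟩
    apply h
    intro i hi
    exact Pi.single_eq_of_ne (M := fun _ : Fin N => ℤ) (by simpa using hi) k

theorem sub_mul_dd (f : LaurentSeries ℂ) (S : Finset (Fin N)) (a b : Fin N) (ha : a ∉ S)
    (hb : b ∉ S) (hab : a ≠ b) :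
    (xVar a - xVar b) * dd f (insert a (insert b S)) = dd f (insert a S) - dd f (insert b S) := by
  ext m
  rw [sub_mul, HahnSeries.coeff_sub, HahnSeries.coeff_sub, xVar, xVar,
    HahnSeries.coeff_single_mul, HahnSeries.coeff_single_mul, one_mul, one_mul, sub_neg_eq_add,
    sub_neg_eq_add]
  change ddCoeff f _ (m + Pi.single a 1) - ddCoeff f _ (m + Pi.single b 1) =
    ddCoeff f _ m - ddCoeff f _ m
  have hcab : (insert a (insert b S)).card = S.card + 2 := by
    rw [Finset.card_insert_of_notMem (by simp [hab, ha]), Finset.card_insert_of_notMem hb]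
  have hca : (insert a S).card = S.card + 1 := Finset.card_insert_of_notMem ha
  have hcb : (insert b S).card = S.card + 1 := Finset.card_insert_of_notMem hb
  have hsum : ∀ c : Fin N, ∑ i, (m + Pi.single c 1 : Fin N → ℤ) i = ∑ i, m i + 1 := fun c => by
    simp [Finset.sum_add_distrib]
  have hne : ∀ c : Fin N, ∀ i ≠ c, (m + Pi.single c 1 : Fin N → ℤ) i = m i := fun c i hi => by
    simp [hi]
  have hself : ∀ c : Fin N, (m + Pi.single c 1 : Fin N → ℤ) c = m c + 1 := fun c => by simp
  have hSa : ∀ i ∈ S, i ≠ a := fun i hi h => ha (h ▸ hi)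
  have hSb : ∀ i ∈ S, i ≠ b := fun i hi h => hb (h ▸ hi)
  have z1 : ∀ c : Fin N, c = a ∨ c = b →
      ((∀ i ∉ insert a (insert b S), (m + Pi.single c 1 : Fin N → ℤ) i = 0) ↔
      ∀ i, i ≠ a → i ≠ b → i ∉ S → m i = 0) := by
    intro c hc
    simp only [Finset.mem_insert, not_or]
    constructor
    · intro h i h1 h2 h3
      rw [← hne c i (by rcases hc with rfl | rfl <;> assumption)]
      exact h i ⟨h1, h2, h3⟩
    · rintro h i ⟨h1, h2, h3⟩
      rw [hne c i (by rcases hc with rfl | rfl <;> assumption)]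
      exact h i h1 h2 h3
  have z2 : (∀ i ∉ insert a S, m i = 0) ↔ (∀ i, i ≠ a → i ≠ b → i ∉ S → m i = 0) ∧ m b = 0 := by
    simp only [Finset.mem_insert, not_or]
    constructor
    · exact fun h => ⟨fun i h1 _ h3 => h i ⟨h1, h3⟩, h b ⟨hab.symm, hb⟩⟩
    · rintro ⟨h, h0⟩ i ⟨h1, h3⟩
      by_cases hi : i = b
      · rw [hi, h0]
      · exact h i h1 hi h3
  have z3 : (∀ i ∉ insert b S, m i = 0) ↔ (∀ i, i ≠ a → i ≠ b → i ∉ S → m i = 0) ∧ m a = 0 := by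
    simp only [Finset.mem_insert, not_or]
    constructor
    · exact fun h => ⟨fun i _ h1 h3 => h i ⟨h1, h3⟩, h a ⟨hab, ha⟩⟩
    · rintro ⟨h, h0⟩ i ⟨h1, h3⟩
      by_cases hi : i = a
      · rw [hi, h0]
      · exact h i hi h1 h3
  have q : ∀ (r : ℤ → Prop) (c : Fin N), c = a ∨ c = b →
      ((∀ i ∈ S, r ((m + Pi.single c 1 : Fin N → ℤ) i)) ↔ ∀ i ∈ S, r (m i)) := by
    intro r c hc
    refine forall₂_congr fun i hi => ?_
    rw [hne c i (by rcases hc with rfl | rfl; exacts [hSa i hi, hSb i hi])]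
  have q1 := q (fun t => t ≤ 0)
  have q2 := q (fun t => 1 ≤ t)
  beta_reduce at q1 q2
  simp only [ddCoeff, z1 a (Or.inl rfl), z1 b (Or.inr rfl), z2, z3, Finset.forall_mem_insert,
    q1 a (Or.inl rfl), q1 b (Or.inr rfl), q2 a (Or.inl rfl), q2 b (Or.inr rfl), hself,
    hne a b hab.symm, hne b a hab, hsum, hcab, hca, hcb]
  have e1 : (∑ i, m i + 1 - ((S.card + 2 : ℕ) : ℤ) + 1) = ∑ i, m i - S.card := by
    push_cast; ring
  have e2 : (∑ i, m i - ((S.card + 1 : ℕ) : ℤ) + 1) = ∑ i, m i - S.card := by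
    push_cast; ring
  rw [e1, e2]
  generalize f.coeff (∑ i, m i - S.card) = v
  rcases Classical.propComplete (∀ i, i ≠ a → i ≠ b → i ∉ S → m i = 0) with hP | hP
  · rcases Classical.propComplete (∀ i ∈ S, m i ≤ 0) with hA | hA <;>
      rcases Classical.propComplete (∀ i ∈ S, 1 ≤ m i) with hB | hB <;>
      simp only [hP, hA, hB, and_true, true_and, and_false, if_false, if_true] <;>
      split_ifs <;> first | (exfalso; omega) | ring
  · simp only [hP, false_and, if_false, sub_self]

theorem newton (f : LaurentSeries ℂ) (j : Fin N) :
    atVar j f = ∑ l, dd f (Finset.Iic l) * ∏ i ∈ Finset.Iio l, (xVar j - xVar i) := by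
  have key : ∀ k : ℕ, k ≤ j → atVar j f =
      ∑ l with l.val < k, dd f (Finset.Iic l) * ∏ i ∈ Finset.Iio l, (xVar j - xVar i) +
        dd f (insert j (Finset.univ.filter fun i : Fin N => i.val < k)) *
          ∏ i with i.val < k, (xVar j - xVar i) := by
    intro k
    induction k with
    | zero =>
      intro _
      simpa using (dd_singleton f j).symm
    | succ k ih =>
      intro hk
      set b : Fin N := ⟨k, by omega⟩ with hb
      have hf : (Finset.univ.filter fun i : Fin N => i.val < k + 1) =
          insert b (Finset.univ.filter fun i : Fin N => i.val < k) := by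
        ext i; simp [hb, Fin.ext_iff]; omega
      have hio : Finset.Iio b = Finset.univ.filter fun i : Fin N => i.val < k := by
        ext i; simp [hb, Fin.lt_def]
      have hic : Finset.Iic b = insert b (Finset.univ.filter fun i : Fin N => i.val < k) := by
        ext i; simp [hb, Fin.le_def, Fin.ext_iff]; omega
      have hbn : b ∉ Finset.univ.filter fun i : Fin N => i.val < k := by simp [hb]
      have hjn : j ∉ Finset.univ.filter fun i : Fin N => i.val < k := by simp; omega
      have hjb : j ≠ b := by rintro h; rw [h] at hk; simp [hb] at hk
      have hs := sub_mul_dd f _ j b hjn hbn hjb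
      rw [ih (by omega), hf, Finset.sum_insert hbn, Finset.prod_insert hbn, hio, hic]
      linear_combination -(∏ i with i.val < k, (xVar j - xVar i)) * hs
  rw [key j le_rfl]
  have hio : Finset.Iio j = Finset.univ.filter fun i : Fin N => i.val < j := by
    ext i; simp
  have hic : Finset.Iic j = insert j (Finset.univ.filter fun i : Fin N => i.val < j) := by
    ext i; simp [le_iff_eq_or_lt]
  have hjn : j ∉ Finset.univ.filter fun i : Fin N => i.val < j := by simp
  rw [← Finset.sum_subset (Finset.subset_univ (Finset.Iic j)), hic, Finset.sum_insert hjn, hio,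
    hic, add_comm]
  intro l _ hl
  rw [Finset.prod_eq_zero (i := j) (by simpa using hl) (sub_self _), mul_zero]

theorem prod_sub_dvd_alternant (f : Fin N → LaurentSeries ℂ) :
    (∏ l : Fin N, ∏ i ∈ Finset.Iio l, (xVar l - xVar i)) ∣ alternant f := by
  have h : (Matrix.of fun i j => atVar j (f i)) =
      (Matrix.of fun i l : Fin N => dd (f i) (Finset.Iic l)) *
        Matrix.of fun l j : Fin N => ∏ i ∈ Finset.Iio l, (xVar j - xVar i) := by
    ext1 i j
    rw [Matrix.mul_apply, Matrix.of_apply, newton]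
    rfl
  rw [alternant, h, Matrix.det_mul]
  have h2 : (Matrix.of fun l j : Fin N => ∏ i ∈ Finset.Iio l, (xVar j - xVar i)).det =
      ∏ l : Fin N, ∏ i ∈ Finset.Iio l, (xVar l - xVar i) := by
    rw [Matrix.det_of_isUpperTriangular]
    · rfl
    · intro l j hlj
      exact Finset.prod_eq_zero (i := j) (by simpa using hlj) (sub_self _)
  rw [h2]
  exact dvd_mul_left _ _

end DividedDifference

theorem alternant_dvd_prod_sub {N : ℕ} (q : ℕ → ℂ[X]) (hd : ∀ n, (q n).natDegree = n)
    (hm : ∀ n, (q n).Monic) (g : Fin N → LaurentSeries ℂ)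
    (hg : ∀ i, g i = NormalizedDeltaOperator.ofPoly (q (Fin.rev i))) :
    alternant g ∣ ∏ l : Fin N, ∏ i ∈ Finset.Iio l, (xVar l - xVar i) := by
  have hev : ∀ (j : Fin N) (r : ℂ[X]), atVar j (NormalizedDeltaOperator.ofPoly r) =
      (r.map (HahnSeries.C : ℂ →+* MultiLaurent N ℂ)).eval (xVar j) := by
    intro j r
    rw [eval_map, NormalizedDeltaOperator.ofPoly, coe_eval₂RingHom, hom_eval₂, atVar_X]
    congr 1
    ext1 c
    exact HahnSeries.embDomainRingHom_C
  have hN := Matrix.det_eval_matrixOfPolynomials_eq_det_vandermonde (fun j : Fin N => xVar j)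
    (fun i => (q i).map HahnSeries.C) (fun i => by rw [(hm i).natDegree_map, hd])
    (fun i => (hm i).map _)
  have hdet : alternant g = (Equiv.Perm.sign (Fin.revPerm : Equiv.Perm (Fin N)) : ℤ) *
      (Matrix.vandermonde fun j : Fin N => xVar j).det := by
    rw [hN, ← Matrix.det_transpose, ← Matrix.det_permute, alternant]
    congr 1
    ext1 i j
    simp [hg, hev]
  have hv : (Matrix.vandermonde fun j : Fin N => xVar j).det =
      ∏ l : Fin N, ∏ i ∈ Finset.Iio l, (xVar l - xVar i) := by
    rw [Matrix.det_vandermonde]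
    exact Finset.prod_comm' (by simp)
  rw [hdet, hv]
  refine ((IsUnit.mul_left_dvd ?_).2 dvd_rfl)
  exact (Units.isUnit _).map (Int.castRingHom (MultiLaurent N ℂ))

/-- The Laurent series `x_a - x_b`, `a ≠ b`, is not a zero divisor. -/
theorem eq_zero_of_sub_mul {N : ℕ} {a b : Fin N} (hab : a ≠ b) {g : MultiLaurent N ℂ}
    (h : (xVar a - xVar b) * g = 0) : g = 0 := by
  have hs : ∀ m : Fin N → ℤ, g.coeff (m + Pi.single a 1) = g.coeff (m + Pi.single b 1) := by
    intro m
    have := congrArg (fun q => HahnSeries.coeff q m) h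
    simpa [sub_mul, xVar, HahnSeries.coeff_single_mul, sub_eq_zero] using this
  by_contra hg
  obtain ⟨m, hm⟩ : ∃ m, g.coeff m ≠ 0 := by
    by_contra! h0
    exact hg (HahnSeries.ext (funext h0))
  have hk : ∀ k : ℕ, g.coeff (m + k • (Pi.single b 1 - Pi.single a 1)) ≠ 0 := by
    intro k
    induction k with
    | zero => simpa using hm
    | succ k ih =>
      have := hs (m + k • (Pi.single b 1 - Pi.single a 1) - Pi.single a 1)
      rw [sub_add_cancel] at this
      rw [this] at ih
      convert ih using 2
      rw [succ_nsmul]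
      abel
  obtain ⟨k, l, hkl, hle⟩ := g.isPWO_support (fun k => ⟨_, hk k⟩)
  have := hle a
  simp [hab] at this
  omega

namespace NormalizedDeltaOperator

variable (Q : NormalizedDeltaOperator) {N : ℕ}

/-- The determinant `det (p_{λ_i + N - i}(x_j))`. -/
noncomputable def schurNum (lam : Fin N → ℤ) : MultiLaurent N ℂ :=
  alternant fun i => Q.p (lam i + N - (i + 1))

/-- The determinant `det (p*_{λ_i + N - i}(x_j))`. -/
noncomputable def schurStarNum (lam : Fin N → ℤ) : MultiLaurent N ℂ :=
  alternant fun i => Q.pStar (lam i + N - (i + 1))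

theorem p_natCast (n : ℕ) : Q.p n = ofPoly (Q.basicPoly n) := rfl

theorem pStar_natCast (n : ℕ) : Q.pStar n = ofPoly (Q.basicPolyStar n) := by
  have h : Q.basicPoly (n + 1) = X * Q.basicPolyStar n := by
    conv_lhs => rw [← X_mul_divX_add (Q.basicPoly (n + 1))]
    rw [coeff_zero_eq_eval_zero, eval_basicPoly_succ, C_0, add_zero, basicPolyStar]
  have h1 : Q.p ((n : ℤ) + 1) = ofPoly (Q.basicPoly (n + 1)) := Q.p_natCast (n + 1)
  have hX : ofPoly X = HahnSeries.single (-1) 1 := by simp [ofPoly]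
  rw [pStar, h1, h, map_mul, hX, ← mul_assoc, HahnSeries.single_mul_single]
  simp

theorem basicPolyStar_spec (n : ℕ) :
    (Q.basicPolyStar n).natDegree = n ∧ (Q.basicPolyStar n).Monic := by
  have h := Q.basicPoly_spec (n + 1)
  have h1 : (Q.basicPolyStar n).natDegree = n := by
    rw [basicPolyStar, natDegree_divX_eq_natDegree_tsub_one, h.1]; rfl
  refine ⟨h1, ?_⟩
  have h2 := h.2.leadingCoeff
  rw [leadingCoeff, h.1, ← coeff_divX] at h2
  rwa [Monic, leadingCoeff, h1]

theorem schurNum_zero_dvd (lam : Fin N → ℤ) : Q.schurNum (0 : Fin N → ℤ) ∣ Q.schurNum lam := by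
  refine (alternant_dvd_prod_sub Q.basicPoly (fun n => (Q.basicPoly_spec n).1)
    (fun n => (Q.basicPoly_spec n).2) _ fun i => ?_).trans (prod_sub_dvd_alternant _)
  rw [← p_natCast]
  congr 1
  rw [Fin.val_rev, Nat.cast_sub (by omega)]
  simp

theorem schurStarNum_zero_dvd (lam : Fin N → ℤ) :
    Q.schurStarNum (0 : Fin N → ℤ) ∣ Q.schurStarNum lam := by
  refine (alternant_dvd_prod_sub Q.basicPolyStar (fun n => (Q.basicPolyStar_spec n).1)
    (fun n => (Q.basicPolyStar_spec n).2) _ fun i => ?_).trans (prod_sub_dvd_alternant _)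
  rw [← pStar_natCast]
  congr 1
  rw [Fin.val_rev, Nat.cast_sub (by omega)]
  simp

/-- The Schur type function `s_λ`: the quotient of `det (p_{λ_i + N - i}(x_j))` by
`det (p_{N - i}(x_j))` in `ℂ((x_1⁻¹, …, x_N⁻¹))`. -/
noncomputable def schur (lam : Fin N → ℤ) : MultiLaurent N ℂ :=
  Classical.choose (Q.schurNum_zero_dvd lam)

theorem schur_spec (lam : Fin N → ℤ) : Q.schurNum lam = Q.schurNum 0 * Q.schur lam :=
  Classical.choose_spec (Q.schurNum_zero_dvd lam)

/-- The Schur type function `s*_λ`: the quotient of `det (p*_{λ_i + N - i}(x_j))` by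
`det (p*_{N - i}(x_j))` in `ℂ((x_1⁻¹, …, x_N⁻¹))`. -/
noncomputable def schurStar (lam : Fin N → ℤ) : MultiLaurent N ℂ :=
  Classical.choose (Q.schurStarNum_zero_dvd lam)

theorem schurStar_spec (lam : Fin N → ℤ) :
    Q.schurStarNum lam = Q.schurStarNum 0 * Q.schurStar lam :=
  Classical.choose_spec (Q.schurStarNum_zero_dvd lam)

end NormalizedDeltaOperator

/-- The binomial coefficient `n (n - 1) ⋯ (n - k + 1) / k!` for `n, k ∈ ℤ`, which is `0` for
`k < 0`. -/
def intChoose (n k : ℤ) : ℤ := if 0 ≤ k then Ring.choose n k.toNat else 0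

/-- `d_{λμ}(u) = det (binom(λ_i + N - i, λ_i - μ_j - i + j) p_{λ_i - μ_j - i + j}(u))`, a polynomial
in `u`.  The entries with `λ_i - μ_j - i + j < 0` vanish. -/
noncomputable def NormalizedDeltaOperator.d (Q : NormalizedDeltaOperator) {N : ℕ}
    (lam mu : Fin N → ℤ) : ℂ[X] :=
  (Matrix.of fun i j : Fin N =>
    ((intChoose (lam i + N - (i + 1)) (lam i - mu j - i + j) : ℤ) : ℂ[X]) *
      Q.basicPoly (lam i - mu j - i + j).toNat).det

/-- `d*_{λμ}(u) = det (binom(λ_i + N - i, λ_i - μ_j - i + j) p*_{λ_i - μ_j - i + j}(u))`, a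
polynomial in `u`.  The entries with `λ_i - μ_j - i + j < 0` vanish. -/
noncomputable def NormalizedDeltaOperator.dStar (Q : NormalizedDeltaOperator) {N : ℕ}
    (lam mu : Fin N → ℤ) : ℂ[X] :=
  (Matrix.of fun i j : Fin N =>
    ((intChoose (lam i + N - (i + 1)) (lam i - mu j - i + j) : ℤ) : ℂ[X]) *
      Q.basicPolyStar (lam i - mu j - i + j).toNat).det

/-- The shift `f(x_1, …, x_N) ↦ f(x_1 + u, …, x_N + u)` from `ℂ((x_1⁻¹, …, x_N⁻¹))` to
`ℂ[u]((x_1⁻¹, …, x_N⁻¹))`: it replaces each monomial `∏ x_i ^ k_i` by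
`∏ (x_i + u) ^ k_i = ∑_j ∏ binom(k_i, j_i) u ^ j_i x_i ^ (k_i - j_i)`.  Only finitely many terms
contribute to each coefficient. -/
noncomputable def shift {N : ℕ} (f : MultiLaurent N ℂ) : MultiLaurent N ℂ[X] where
  coeff m := ∑ᶠ j : Fin N → ℕ,
    C (f.coeff (fun i => m i - j i) * ∏ i, ((Ring.choose ((j i : ℤ) - m i) (j i) : ℤ) : ℂ)) *
      X ^ (∑ i, j i)
  isPWO_support' := by
    have hu : (Set.univ : Set (Fin N → ℕ)).IsPWO := Set.isPWO_of_wellQuasiOrderedLE _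
    have hm : Monotone (fun (j : Fin N → ℕ) (i : Fin N) => (j i : ℤ)) := by
      intro j k hjk i
      have h1 : j i ≤ k i := hjk i
      change (j i : ℤ) ≤ (k i : ℤ)
      exact_mod_cast h1
    refine (f.isPWO_support.add (hu.image_of_monotone hm)).mono fun m hm => ?_
    obtain ⟨j, hj⟩ : ∃ j : Fin N → ℕ, f.coeff (fun i => m i - j i) ≠ 0 := by
      by_contra! h
      exact hm (by simp [h])
    refine Set.mem_add.2 ⟨_, hj, _, ⟨j, trivial, rfl⟩, ?_⟩
    funext i
    simp

/-- The inclusion of `ℂ((x_1⁻¹, …, x_N⁻¹))` in `ℂ[u]((x_1⁻¹, …, x_N⁻¹))`. -/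
noncomputable def constInU {N : ℕ} (f : MultiLaurent N ℂ) : MultiLaurent N ℂ[X] :=
  f.map (C : ℂ →+* ℂ[X])

/-- `g` is the sum of the family `F` of formal Laurent series: the supports of all members are
contained in a common set of admissible exponents, each monomial occurs in finitely many members
only, and the coefficients of `g` are the sums of the coefficients. -/
def HasFormalSum {N : ℕ} {R ι : Type*} [AddCommMonoid R] (F : ι → MultiLaurent N R)
    (g : MultiLaurent N R) : Prop :=
  ∃ S : HahnSeries.SummableFamily (Fin N → ℤ) R ι, (∀ i, S i = F i) ∧ S.hsum = g

end SchurType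

/-!
The theorem is the Cauchy–Binet formula applied to one-variable expansions. For one variable,
`exp (u t) = ∑ p_k(u) Q(t) ^ k / k!`, so the shift by `u` acts on `ℂ((x⁻¹))` as
`∑ p_k(u) Q ^ k / k!`. Since `Q p_n = n p_{n-1}` and `Q p*_n = n p*_{n-1}` for all `n ∈ ℤ`, this gives
`p_n(x + u) = ∑ binom(n, k) p_k(u) p_{n-k}(x)` and the same with `p*_n`, `p*_{n-k}`
(`binomialShift_p`, `binomialShift_pStar`). The relations for `Q` outside the range in which they
define the sequences come from the Pincherle derivative `Q' = Q x - x Q`, which maps `p*_n` to `p_n`.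
Subtracting `x p*_n(x + u)` from `p_{n+1}(x + u) = (x + u) p*_n(x + u)` and cancelling `u` yields
`p*_n(x + u) = ∑ binom(n, k) p*_k(u) p_{n-k}(x)` (`binomialShift_pStar_p`).

The coefficient of an alternant `det (f_i(x_j))` at a monomial is a determinant of coefficients of the
`f_i`, and in each such coefficient only finitely many terms of the one-variable expansions matter.
A finite Cauchy–Binet formula (`det_sum_mul`) therefore expands the shifted numerator of `s_λ` or
`s*_λ`; the strictly decreasing sequences `μ_i + N - i` over which it sums correspond to the weakly
decreasing `μ`, and the minor `d_{λμ}(u)` vanishes unless `μ ≤ λ` (`shiftDet_eq_zero`).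

All denominators are the same Vandermonde determinant. It is invariant under the shift and not a zero
divisor, so it can be cancelled once the family `d_{λμ}(u) s_μ` is known to be summable. This holds
because `s_μ` is, up to sign, a determinant of divided differences (`exponentsGE_quotient`): its
exponents are bounded uniformly for `μ ≤ λ`, and its total degree is at most `|μ|` plus a constant, so
that a given monomial occurs for finitely many `μ ≤ λ` only.
-/

namespace SchurType

/-! ### Power series in `D` acting on `ℂ((x⁻¹))` -/

/-- The scalar `(1 - e) (2 - e) ⋯ (k - e)`, by which `D ^ k` maps the coefficient at `e - k` to the
coefficient at `e` (exponents of `x⁻¹`). -/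
noncomputable def iterCoeff (e : ℤ) (k : ℕ) : ℂ := ∏ i ∈ Finset.range k, ((i : ℂ) + 1 - e)

theorem iterCoeff_succ (e : ℤ) (k : ℕ) :
    iterCoeff e (k + 1) = iterCoeff e k * ((k : ℂ) + 1 - e) := by
  rw [iterCoeff, Finset.prod_range_succ, iterCoeff]

theorem iterCoeff_add (e : ℤ) (i j : ℕ) :
    iterCoeff e (i + j) = iterCoeff e i * iterCoeff (e - i) j := by
  simp only [iterCoeff, Finset.prod_range_add]
  congr 1
  refine Finset.prod_congr rfl fun l _ => ?_
  push_cast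
  ring

theorem factorial_mul_choose (e : ℤ) (k : ℕ) :
    (k.factorial : ℂ) * ((Ring.choose ((k : ℤ) - e) k : ℤ) : ℂ) = iterCoeff e k := by
  have h := Ring.descPochhammer_eq_factorial_smul_choose ((k : ℤ) - e) k
  rw [← Polynomial.eval_eq_smeval, descPochhammer_eval_eq_prod_range, nsmul_eq_mul] at h
  have h2 := congrArg (Int.cast : ℤ → ℂ) h
  push_cast at h2
  rw [← h2, iterCoeff, ← Finset.prod_range_reflect]
  refine Finset.prod_congr rfl fun i hi => ?_
  have hi := Finset.mem_range.1 hi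
  rw [Nat.cast_sub (by omega), Nat.cast_sub (by omega)]
  push_cast
  ring

theorem coeff_derivX_iterate (f : LaurentSeries ℂ) (k : ℕ) (e : ℤ) :
    (derivX^[k] f).coeff e = iterCoeff e k * f.coeff (e - k) := by
  induction k generalizing e with
  | zero => simp [iterCoeff]
  | succ k ih =>
    rw [Function.iterate_succ_apply']
    change ((1 - e : ℤ) : ℂ) * (derivX^[k] f).coeff (e - 1) = _
    rw [ih, add_comm k 1, iterCoeff_add]
    have : e - 1 - (k : ℤ) = e - ((1 + k : ℕ) : ℤ) := by push_cast; ring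
    rw [this]
    simp [iterCoeff]
    ring

/-- The action of `φ(D) = ∑ φ_k D ^ k` on `ℂ((x⁻¹))`. -/
noncomputable def psAct (φ : PowerSeries ℂ) (f : LaurentSeries ℂ) : LaurentSeries ℂ :=
  HahnSeries.ofSuppBddBelow
    (fun n => ∑ᶠ k : ℕ, PowerSeries.coeff k φ * (derivX^[k] f).coeff n) (by
    refine ⟨f.order, fun n hn => ?_⟩
    obtain ⟨k, hk⟩ : ∃ k : ℕ, PowerSeries.coeff k φ * (derivX^[k] f).coeff n ≠ 0 := by
      by_contra! h
      exact hn (by simp [h])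
    have := order_le_of_coeff_derivX_iterate f k n (right_ne_zero_of_mul hk)
    omega)

theorem exists_coeff_sub_eq_zero (f : LaurentSeries ℂ) (e : ℤ) :
    ∃ M : ℕ, ∀ k : ℕ, M ≤ k → f.coeff (e - k) = 0 := by
  refine ⟨(e - f.order + 1).toNat, fun k hk => ?_⟩
  by_contra h
  have := HahnSeries.order_le_of_coeff_ne_zero h
  omega

theorem coeff_psAct (φ : PowerSeries ℂ) {f : LaurentSeries ℂ} {e : ℤ} {M : ℕ}
    (hM : ∀ k : ℕ, M ≤ k → f.coeff (e - k) = 0) :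
    (psAct φ f).coeff e =
      ∑ k ∈ Finset.range M, PowerSeries.coeff k φ * (iterCoeff e k * f.coeff (e - k)) := by
  change ∑ᶠ k : ℕ, PowerSeries.coeff k φ * (derivX^[k] f).coeff e = _
  simp only [coeff_derivX_iterate]
  refine finsum_eq_sum_of_support_subset _ fun k hk => ?_
  by_contra h
  exact hk (by simp only [hM k (by simpa using h), mul_zero])

theorem psAct_add (φ : PowerSeries ℂ) (f g : LaurentSeries ℂ) :
    psAct φ (f + g) = psAct φ f + psAct φ g := by
  ext e
  obtain ⟨M, hM⟩ := exists_coeff_sub_eq_zero f e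
  obtain ⟨M', hM'⟩ := exists_coeff_sub_eq_zero g e
  have h1 : ∀ k : ℕ, M + M' ≤ k → f.coeff (e - k) = 0 := fun k hk => hM k (by omega)
  have h2 : ∀ k : ℕ, M + M' ≤ k → g.coeff (e - k) = 0 := fun k hk => hM' k (by omega)
  rw [HahnSeries.coeff_add, coeff_psAct φ h1, coeff_psAct φ h2,
    coeff_psAct φ (M := M + M') (fun k hk => by
      rw [HahnSeries.coeff_add, h1 k hk, h2 k hk, add_zero]),
    ← Finset.sum_add_distrib]
  refine Finset.sum_congr rfl fun k _ => ?_
  rw [HahnSeries.coeff_add]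
  ring

theorem psAct_smul (φ : PowerSeries ℂ) (a : ℂ) (f : LaurentSeries ℂ) :
    psAct φ (a • f) = a • psAct φ f := by
  ext e
  obtain ⟨M, hM⟩ := exists_coeff_sub_eq_zero f e
  rw [HahnSeries.coeff_smul, coeff_psAct φ hM,
    coeff_psAct φ (M := M) (fun k hk => by rw [HahnSeries.coeff_smul, hM k hk, smul_zero]),
    Finset.smul_sum]
  refine Finset.sum_congr rfl fun k _ => ?_
  rw [HahnSeries.coeff_smul, smul_eq_mul, smul_eq_mul]
  ring

theorem psAct_one (f : LaurentSeries ℂ) : psAct 1 f = f := by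
  ext e
  obtain ⟨M, hM⟩ := exists_coeff_sub_eq_zero f e
  rw [coeff_psAct 1 (M := M + 1) fun k hk => hM k (by omega), Finset.sum_eq_single 0]
  · simp [iterCoeff]
  · intro k _ hk
    simp [PowerSeries.coeff_one, hk]
  · simp

theorem psAct_mul (φ ψ : PowerSeries ℂ) (f : LaurentSeries ℂ) :
    psAct (φ * ψ) f = psAct φ (psAct ψ f) := by
  ext e
  obtain ⟨M, hM⟩ := exists_coeff_sub_eq_zero f e
  have h1 : ∀ i : ℕ, ∀ k : ℕ, M ≤ k → f.coeff (e - i - k) = 0 := fun i k hk => by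
    have := hM (i + k) (by omega)
    rwa [Nat.cast_add, ← sub_sub] at this
  have h2 : ∀ i : ℕ, M ≤ i → (psAct ψ f).coeff (e - i) = 0 := fun i hi => by
    rw [coeff_psAct ψ (h1 i)]
    refine Finset.sum_eq_zero fun k _ => ?_
    have := hM (i + k) (by omega)
    rw [Nat.cast_add, ← sub_sub] at this
    simp [this]
  rw [coeff_psAct φ h2, coeff_psAct _ hM]
  set F : ℕ × ℕ → ℂ := fun x => PowerSeries.coeff x.1 φ * PowerSeries.coeff x.2 ψ *
    (iterCoeff e (x.1 + x.2) * f.coeff (e - (x.1 + x.2 : ℕ))) with hF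
  have hl : ∀ k, PowerSeries.coeff k (φ * ψ) * (iterCoeff e k * f.coeff (e - k)) =
      ∑ x ∈ Finset.HasAntidiagonal.antidiagonal k, F x := by
    intro k
    rw [PowerSeries.coeff_mul, Finset.sum_mul]
    refine Finset.sum_congr rfl fun x hx => ?_
    simp only [hF, Finset.HasAntidiagonal.mem_antidiagonal.1 hx]
  have hr : ∀ i, PowerSeries.coeff i φ * (iterCoeff e i * (psAct ψ f).coeff (e - i)) =
      ∑ j ∈ Finset.range M, F (i, j) := by
    intro i
    rw [coeff_psAct ψ (h1 i), Finset.mul_sum, Finset.mul_sum]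
    refine Finset.sum_congr rfl fun j _ => ?_
    simp only [hF, iterCoeff_add, Nat.cast_add, sub_sub]
    ring
  simp only [hl, hr]
  rw [← Finset.sum_product', Finset.sum_sigma']
  refine Finset.sum_bij_ne_zero (fun x _ _ => x.2) ?_ ?_ ?_ ?_
  · rintro ⟨k, x⟩ hx _
    simp only [Finset.mem_sigma, Finset.mem_range, Finset.HasAntidiagonal.mem_antidiagonal] at hx
    simp only [Finset.mem_product, Finset.mem_range]
    omega
  · rintro ⟨k, x⟩ hx _ ⟨l, y⟩ hy _ h
    simp only [Finset.mem_sigma, Finset.HasAntidiagonal.mem_antidiagonal] at hx hy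
    subst h
    obtain rfl := hx.2.symm.trans hy.2
    rfl
  · rintro ⟨i, j⟩ _ hne
    refine ⟨⟨i + j, (i, j)⟩, ?_, hne, rfl⟩
    simp only [Finset.mem_sigma, Finset.mem_range,
      Finset.HasAntidiagonal.mem_antidiagonal, and_true]
    by_contra h
    exact hne (by simp only [hF, hM (i + j) (by omega), mul_zero])
  · intro _ _ _
    rfl

theorem coeff_X_mul (f : LaurentSeries ℂ) (e : ℤ) :
    (HahnSeries.single (-1 : ℤ) (1 : ℂ) * f).coeff e = f.coeff (e + 1) := by
  rw [HahnSeries.coeff_single_mul, one_mul, sub_neg_eq_add]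

theorem X_mul_smul (a : ℂ) (f : LaurentSeries ℂ) :
    HahnSeries.single (-1 : ℤ) (1 : ℂ) * (a • f) = a • (HahnSeries.single (-1 : ℤ) (1 : ℂ) * f) := by
  ext e
  simp only [coeff_X_mul, HahnSeries.coeff_smul]

theorem coeff_X_inv_mul (f : LaurentSeries ℂ) (e : ℤ) :
    (HahnSeries.single (1 : ℤ) (1 : ℂ) * f).coeff e = f.coeff (e - 1) := by
  rw [HahnSeries.coeff_single_mul, one_mul]

/-- The commutator of `φ(D)` and multiplication by `x` is `φ'(D)`. -/
theorem psAct_X_mul (φ : PowerSeries ℂ) (f : LaurentSeries ℂ) :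
    psAct φ (HahnSeries.single (-1) 1 * f) =
      HahnSeries.single (-1) 1 * psAct φ f + psAct (PowerSeries.derivative ℂ φ) f := by
  ext e
  obtain ⟨M, hM⟩ := exists_coeff_sub_eq_zero f e
  have h1 : ∀ k : ℕ, M + 1 ≤ k → f.coeff (e + 1 - k) = 0 := fun k hk => by
    have := hM (k - 1) (by omega)
    rwa [Nat.cast_sub (by omega), Nat.cast_one, show e - ((k : ℤ) - 1) = e + 1 - k by ring] at this
  have h2 : ∀ k : ℕ, M + 1 ≤ k →
      (HahnSeries.single (-1 : ℤ) (1 : ℂ) * f).coeff (e - k) = 0 := fun k hk => by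
    rw [coeff_X_mul, show e - (k : ℤ) + 1 = e + 1 - k by ring, h1 k hk]
  rw [HahnSeries.coeff_add, coeff_X_mul, coeff_psAct _ h1, coeff_psAct _ h2, coeff_psAct _ hM,
    Finset.sum_range_succ', Finset.sum_range_succ' (n := M), add_right_comm,
    ← Finset.sum_add_distrib]
  congr 1
  · refine Finset.sum_congr rfl fun k _ => ?_
    rw [coeff_X_mul, PowerSeries.coeff_derivative]
    have e1 : e - ((k + 1 : ℕ) : ℤ) + 1 = e - k := by push_cast; ring
    have e2 : e + 1 - ((k + 1 : ℕ) : ℤ) = e - k := by push_cast; ring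
    rw [e1, e2, iterCoeff_succ]
    have e3 : iterCoeff (e + 1) (k + 1) = -e * iterCoeff e k := by
      rw [add_comm k 1, iterCoeff_add]
      simp [iterCoeff]
    rw [e3]
    ring
  · simp [iterCoeff, coeff_X_mul]

theorem iterCoeff_eq_zero {e : ℤ} {k : ℕ} (h1 : 1 ≤ e) (h2 : e ≤ k) : iterCoeff e k = 0 := by
  obtain ⟨i, rfl⟩ : ∃ i : ℕ, e = i + 1 := ⟨(e - 1).toNat, by omega⟩
  refine Finset.prod_eq_zero (i := i) (Finset.mem_range.2 (by omega)) ?_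
  push_cast
  ring

/-- `φ(D)` preserves the polynomials: a derivative has no terms `x ^ (-k)`, `k ≥ 1`, unless the
series has. -/
theorem coeff_psAct_eq_zero_of_pos (φ : PowerSeries ℂ) {f : LaurentSeries ℂ}
    (hf : ∀ e : ℤ, 1 ≤ e → f.coeff e = 0) {e : ℤ} (he : 1 ≤ e) : (psAct φ f).coeff e = 0 := by
  obtain ⟨M, hM⟩ := exists_coeff_sub_eq_zero f e
  rw [coeff_psAct φ hM]
  refine Finset.sum_eq_zero fun k _ => ?_
  by_cases h : e ≤ k
  · rw [iterCoeff_eq_zero he h, zero_mul, mul_zero]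
  · rw [hf _ (by omega), mul_zero, mul_zero]

theorem coeff_ofPoly (f : ℂ[X]) (e : ℤ) :
    (NormalizedDeltaOperator.ofPoly f).coeff e = if e ≤ 0 then f.coeff (-e).toNat else 0 := by
  induction f using Polynomial.induction_on' with
  | add f g hf hg =>
    rw [map_add, HahnSeries.coeff_add, hf, hg]
    split_ifs <;> simp
  | monomial n a =>
    have : NormalizedDeltaOperator.ofPoly (monomial n a) = HahnSeries.single (-(n : ℤ)) a := by
      simp [NormalizedDeltaOperator.ofPoly, eval₂_monomial, HahnSeries.C_apply]
    rw [this, HahnSeries.coeff_single, coeff_monomial]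
    split_ifs <;> first | rfl | (exfalso; omega)

theorem ofPoly_smul (a : ℂ) (f : ℂ[X]) :
    NormalizedDeltaOperator.ofPoly (a • f) = a • NormalizedDeltaOperator.ofPoly f := by
  ext e
  rw [HahnSeries.coeff_smul, coeff_ofPoly, coeff_ofPoly]
  split_ifs <;> simp

theorem coeff_ofPoly_of_pos (f : ℂ[X]) {e : ℤ} (he : 1 ≤ e) :
    (NormalizedDeltaOperator.ofPoly f).coeff e = 0 := by
  rw [coeff_ofPoly, if_neg (by omega)]

theorem exists_ofPoly_eq {f : LaurentSeries ℂ} (hf : ∀ e : ℤ, 1 ≤ e → f.coeff e = 0) :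
    ∃ g : ℂ[X], NormalizedDeltaOperator.ofPoly g = f := by
  obtain ⟨M, hM⟩ := exists_coeff_sub_eq_zero f 0
  refine ⟨∑ k ∈ Finset.range M, monomial k (f.coeff (-k)), ?_⟩
  ext e
  rw [coeff_ofPoly]
  split_ifs with he
  · obtain ⟨k, rfl⟩ : ∃ k : ℕ, e = -k := ⟨(-e).toNat, by omega⟩
    simp only [finsetSum_coeff, coeff_monomial, neg_neg, Int.toNat_natCast, Finset.sum_ite_eq',
      Finset.mem_range]
    split_ifs with hk
    · rfl
    · rw [← zero_sub, hM k (by omega)]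
  · rw [hf e (by omega)]

theorem ofPoly_injective : Function.Injective NormalizedDeltaOperator.ofPoly := by
  intro f g h
  ext n
  have := congrArg (fun s => HahnSeries.coeff s (-(n : ℤ))) h
  simpa [coeff_ofPoly] using this

namespace NormalizedDeltaOperator

variable (Q : NormalizedDeltaOperator)

/-! ### The two sequences of one-variable series -/

/-- The power series `∑ a_k t ^ k` with `Q = ∑ a_k D ^ k`. -/
noncomputable def series : PowerSeries ℂ := PowerSeries.mk (dCoeff Q.toLin)

theorem coeff_zero_series : PowerSeries.coeff 0 Q.series = 0 := by
  have h := Q.map_C 1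
  rw [C_1] at h
  simp [series, dCoeff, h]

theorem coeff_one_series : PowerSeries.coeff 1 Q.series = 1 := by
  rw [series, PowerSeries.coeff_mk, Q.normalized]

theorem onLaurent_eq_psAct (f : LaurentSeries ℂ) : Q.onLaurent f = psAct Q.series f := by
  ext e
  change ∑ᶠ k : ℕ, dCoeff Q.toLin k * (derivX^[k] f).coeff e =
    ∑ᶠ k : ℕ, PowerSeries.coeff k Q.series * (derivX^[k] f).coeff e
  simp only [series, PowerSeries.coeff_mk]

theorem psAct_ofPoly_X_pow (m : ℕ) :
    psAct Q.series (ofPoly (X ^ m)) = ofPoly (Q.toLin (X ^ m)) := by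
  ext e
  have h0 : ∀ k : ℕ, m + e < k → (ofPoly (X ^ m)).coeff (e - k) = 0 := fun k hk => by
    rw [coeff_ofPoly, coeff_X_pow]
    split_ifs <;> first | rfl | (exfalso; omega)
  rw [coeff_psAct _ (M := (m + e + 1).toNat) fun k hk => h0 k (by omega), coeff_ofPoly,
    toLin_X_pow, finsetSum_coeff]
  simp only [coeff_C_mul, coeff_X_pow]
  by_cases he : e ≤ 0 ∧ -(m : ℤ) ≤ e
  · obtain ⟨k, rfl⟩ : ∃ k : ℕ, e = k - m := ⟨(e + m).toNat, by omega⟩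
    rw [if_pos he.1, Finset.sum_eq_single k, Finset.sum_eq_single k]
    · rw [coeff_ofPoly, coeff_X_pow, if_pos (by omega), if_pos (by omega), if_pos (by omega),
        series, PowerSeries.coeff_mk, dCoeff, ← factorial_mul_choose, sub_sub_cancel,
        Ring.choose_natCast]
      have : (k.factorial : ℂ) ≠ 0 := by exact_mod_cast k.factorial_ne_zero
      push_cast
      field_simp
    · intro l hl hlk
      rw [if_neg (by have := Finset.mem_range.1 hl; omega), mul_zero]
    · intro h
      exact absurd (Finset.mem_range.2 (by omega)) h
    · intro l _ hlk
      rw [coeff_ofPoly, coeff_X_pow]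
      split_ifs <;> first | (exfalso; omega) | simp
    · intro h
      exact absurd (Finset.mem_range.2 (by omega)) h
  · have hr : (if e ≤ 0 then ∑ l ∈ Finset.range (m + 1),
        ((m.choose l : ℂ) * (Q.toLin (X ^ l)).eval 0) * (if (-e).toNat = m - l then 1 else 0)
        else (0 : ℂ)) = 0 := by
      split_ifs with h1
      · refine Finset.sum_eq_zero fun l hl => ?_
        rw [if_neg (by have := Finset.mem_range.1 hl; omega), mul_zero]
      · rfl
    rw [hr]
    refine Finset.sum_eq_zero fun l hl => ?_
    have hl := Finset.mem_range.1 hl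
    by_cases h2 : e ≤ l
    · rw [iterCoeff_eq_zero (by omega) h2, zero_mul, mul_zero]
    · rw [coeff_ofPoly_of_pos _ (by omega), mul_zero, mul_zero]

theorem psAct_ofPoly (f : ℂ[X]) : psAct Q.series (ofPoly f) = ofPoly (Q.toLin f) := by
  induction f using Polynomial.induction_on' with
  | add f g hf hg => rw [map_add, psAct_add, hf, hg, map_add, map_add]
  | monomial n a =>
    rw [← C_mul_X_pow_eq_monomial, ← smul_eq_C_mul, ofPoly_smul, psAct_smul, psAct_ofPoly_X_pow,
      map_smul, ofPoly_smul]

theorem X_mul_pStar (n : ℤ) : HahnSeries.single (-1) 1 * Q.pStar n = Q.p (n + 1) := by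
  rw [pStar, ← mul_assoc, HahnSeries.single_mul_single]
  simp

theorem pStar_negSucc (m : ℕ) : Q.pStar (Int.negSucc m) = Q.negStar m := by
  rcases m with _ | m
  · have h : Q.p 0 = 1 := by
      have := Q.p_natCast 0
      rwa [basicPoly_zero, map_one] at this
    rw [pStar, show Int.negSucc 0 + 1 = 0 from rfl, h, mul_one]
    rfl
  · have h : Int.negSucc (m + 1) + 1 = Int.negSucc m := by omega
    rw [pStar, h]
    change HahnSeries.single 1 1 * (HahnSeries.single (-1) 1 * Q.negStar (m + 1)) = _
    rw [← mul_assoc, HahnSeries.single_mul_single]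
    simp

/-- `Q p_n = n p_{n-1}` for `n ≥ 0`. -/
theorem psAct_p_natCast (n : ℕ) : psAct Q.series (Q.p n) = (n : ℂ) • Q.p (n - 1) := by
  rw [p_natCast, psAct_ofPoly]
  rcases n with _ | n
  · rw [basicPoly_zero, ← C_1, Q.map_C]
    ext e
    simp
  · rw [map_basicPoly_succ, ofPoly_smul, ← p_natCast]
    push_cast
    rw [add_sub_cancel_right]

/-- `Q p*_n = n p*_{n-1}` for `n < 0`, by definition. -/
theorem psAct_pStar_negSucc (m : ℕ) : psAct Q.series (Q.pStar (Int.negSucc m)) =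
    ((Int.negSucc m : ℤ) : ℂ) • Q.pStar (Int.negSucc m - 1) := by
  have h : Int.negSucc m - 1 = Int.negSucc (m + 1) := by omega
  have hm : ((m : ℂ) + 1) ≠ 0 := by exact_mod_cast m.succ_ne_zero
  rw [h, pStar_negSucc, pStar_negSucc, negStar, HahnSeries.C_mul_eq_smul, smul_smul,
    ← onLaurent_eq_psAct, Int.cast_negSucc]
  push_cast
  rw [show -((m : ℂ) + 1) * -((m : ℂ) + 1)⁻¹ = 1 by field_simp, one_smul]

/-- The constants form the kernel of `Q` on `ℂ[x]`. -/
theorem eq_C_of_toLin_eq_zero {f : ℂ[X]} (h : Q.toLin f = 0) : f = C (f.eval 0) := by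
  rcases Nat.eq_zero_or_pos f.natDegree with h0 | hpos
  · rw [eq_C_of_natDegree_eq_zero h0]
    simp
  · exfalso
    obtain ⟨m, hm⟩ : ∃ m, f.natDegree = m + 1 := ⟨f.natDegree - 1, by omega⟩
    have hf0 : f ≠ 0 := by rintro rfl; simp at hm
    have := Q.degree_map f m (by rw [degree_eq_natDegree hf0, hm])
    rw [h] at this
    simp at this

/-- The Pincherle derivative `Q'` of `Q` maps `p*_n` to `p_n`. For `n ≥ 0` the preimage `r` of `p_n`
under the invertible operator `Q'` is a polynomial with `Q (x r) = (n + 1) p_n`, whence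
`x r = p_{n+1}`. -/
theorem psAct_pStar_natCast (n : ℕ) :
    psAct (PowerSeries.derivative ℂ Q.series) (Q.pStar n) = Q.p n ∧
      psAct Q.series (Q.pStar n) = (n : ℂ) • Q.pStar (n - 1) := by
  set q' := PowerSeries.derivative ℂ Q.series with hq'
  have hq0 : PowerSeries.constantCoeff q' ≠ 0 := by
    rw [← PowerSeries.coeff_zero_eq_constantCoeff_apply, hq', PowerSeries.coeff_derivative,
      zero_add, coeff_one_series]
    simp
  have hinv : q' * q'⁻¹ = 1 := PowerSeries.mul_inv_cancel _ hq0
  have key : ∀ n : ℕ, psAct Q.series (psAct q'⁻¹ (Q.p n)) = (n : ℂ) • Q.pStar (n - 1) →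
      psAct q' (Q.pStar n) = Q.p n ∧ psAct Q.series (Q.pStar n) = (n : ℂ) • Q.pStar (n - 1) := by
    intro n hr
    set r := psAct q'⁻¹ (Q.p n) with hrdef
    have h1 : psAct q' r = Q.p n := by rw [hrdef, ← psAct_mul, hinv, psAct_one]
    obtain ⟨g, hg⟩ := exists_ofPoly_eq (f := r) fun e he =>
      coeff_psAct_eq_zero_of_pos _ (fun e he => by rw [p_natCast, coeff_ofPoly_of_pos _ he]) he
    have hX : ofPoly X = HahnSeries.single (-1) 1 := by simp [ofPoly]
    have h2 : psAct Q.series (ofPoly (X * g)) = psAct Q.series (ofPoly (Q.basicPoly (n + 1))) := by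
      have hn := Q.psAct_p_natCast (n + 1)
      rw [p_natCast] at hn
      rw [hn, map_mul, hX, hg, psAct_X_mul, hr, ← hq', h1, X_mul_smul, X_mul_pStar,
        sub_add_cancel]
      push_cast
      rw [add_sub_cancel_right]
      ext e
      simp only [HahnSeries.coeff_add, HahnSeries.coeff_smul, smul_eq_mul]
      ring
    have h3 : Q.toLin (X * g - Q.basicPoly (n + 1)) = 0 := by
      rw [psAct_ofPoly, psAct_ofPoly] at h2
      rw [map_sub, ofPoly_injective h2, sub_self]
    have h4 := Q.eq_C_of_toLin_eq_zero h3
    rw [eval_sub, eval_basicPoly_succ, eval_mul, eval_X, zero_mul, sub_self, C_0,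
      sub_eq_zero] at h4
    have h5 : Q.pStar n = r := by
      have : Q.p ((n : ℤ) + 1) = ofPoly (Q.basicPoly (n + 1)) := Q.p_natCast (n + 1)
      rw [pStar, this, ← h4, map_mul, hX, hg, ← mul_assoc, HahnSeries.single_mul_single]
      simp
    rw [h5]
    exact ⟨h1, hr⟩
  induction n with
  | zero =>
    refine key 0 ?_
    rw [← psAct_mul, mul_comm, psAct_mul, psAct_p_natCast]
    ext e
    rw [psAct_smul]
    simp
  | succ n ih =>
    refine key (n + 1) ?_
    have e1 : (((n + 1 : ℕ) : ℤ) - 1) = n := by push_cast; ring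
    rw [← psAct_mul, mul_comm, psAct_mul, psAct_p_natCast, psAct_smul, e1, ← ih.1, ← psAct_mul,
      mul_comm, hinv, psAct_one]

theorem psAct_pStar (n : ℤ) : psAct Q.series (Q.pStar n) = (n : ℂ) • Q.pStar (n - 1) := by
  rcases n with n | m
  · exact_mod_cast (Q.psAct_pStar_natCast n).2
  · exact Q.psAct_pStar_negSucc m

/-- The commutator relation `Q x - x Q = Q'` applied to `p*_{n-1}`. -/
theorem psAct_derivative_pStar_sub_one (n : ℤ) :
    psAct (PowerSeries.derivative ℂ Q.series) (Q.pStar (n - 1)) =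
      psAct Q.series (Q.p n) - ((n - 1 : ℤ) : ℂ) • Q.p (n - 1) := by
  have h := X_mul_pStar Q (n - 1)
  rw [sub_add_cancel] at h
  have h2 := X_mul_pStar Q (n - 1 - 1)
  rw [sub_add_cancel] at h2
  rw [← h, psAct_X_mul, psAct_pStar, X_mul_smul, h2, add_sub_cancel_left]

/-- The Pincherle derivative maps `p*_n` to `p_n` for `n < 0` too. In the step from `n` to `n - 1`,
`n Q' p*_{n-1} = Q' Q p*_n = Q p_n`, which is `(n - 1) p_{n-1} + Q' p*_{n-1}` by the commutator
relation. -/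
theorem psAct_derivative_pStar_negSucc (m : ℕ) :
    psAct (PowerSeries.derivative ℂ Q.series) (Q.pStar (Int.negSucc m)) = Q.p (Int.negSucc m) := by
  induction m with
  | zero =>
    have h := Q.psAct_derivative_pStar_sub_one 0
    have h0 := Q.psAct_p_natCast 0
    rw [Nat.cast_zero, Nat.cast_zero] at h0
    rw [h0] at h
    ext e
    have h1 := congrArg (fun s => HahnSeries.coeff s e) h
    simpa using h1
  | succ m ih =>
    have hn : Int.negSucc (m + 1) = Int.negSucc m - 1 := by omega
    have h := Q.psAct_derivative_pStar_sub_one (Int.negSucc m)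
    rw [hn]
    have hm : (((Int.negSucc m - 1 : ℤ)) : ℂ) ≠ 0 := by
      exact_mod_cast (by omega : Int.negSucc m - 1 ≠ 0)
    have h2 : psAct Q.series (Q.p (Int.negSucc m)) = ((Int.negSucc m : ℤ) : ℂ) •
        psAct (PowerSeries.derivative ℂ Q.series) (Q.pStar (Int.negSucc m - 1)) := by
      rw [← ih, ← psAct_mul, mul_comm, psAct_mul, psAct_pStar, psAct_smul]
    rw [h2] at h
    ext e
    have h1 := congrArg (fun s => HahnSeries.coeff s e) h
    simp only [HahnSeries.coeff_sub, HahnSeries.coeff_smul, smul_eq_mul] at h1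
    refine mul_left_cancel₀ hm ?_
    push_cast at h1 ⊢
    linear_combination -h1

theorem psAct_p (n : ℤ) : psAct Q.series (Q.p n) = (n : ℂ) • Q.p (n - 1) := by
  rcases n with n | m
  · exact_mod_cast Q.psAct_p_natCast n
  · have h := Q.psAct_derivative_pStar_sub_one (Int.negSucc m)
    have h2 := Q.psAct_derivative_pStar_negSucc (m + 1)
    rw [show Int.negSucc (m + 1) = Int.negSucc m - 1 by omega] at h2
    rw [h2] at h
    ext e
    have h1 := congrArg (fun s => HahnSeries.coeff s e) h
    simp only [HahnSeries.coeff_sub, HahnSeries.coeff_smul, smul_eq_mul] at h1 ⊢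
    rw [Int.cast_sub, Int.cast_one] at h1
    linear_combination -h1

theorem coeff_p_eq_zero {n e : ℤ} (h : n + e < 0) : (Q.p n).coeff e = 0 := by
  have hneg : ∀ (m : ℕ) (e : ℤ), e < m + 1 → (Q.negStar m).coeff e = 0 := by
    intro m
    induction m with
    | zero =>
      intro e he
      rw [negStar, HahnSeries.coeff_single_of_ne (by simp at he; omega)]
    | succ m ih =>
      intro e he
      rw [negStar, HahnSeries.C_mul_eq_smul, HahnSeries.coeff_smul, onLaurent_eq_psAct]
      obtain ⟨M, hM⟩ := exists_coeff_sub_eq_zero (Q.negStar m) e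
      rw [coeff_psAct _ hM, Finset.sum_eq_zero, smul_zero]
      intro k _
      rcases k with _ | k
      · rw [coeff_zero_series, zero_mul]
      · rw [ih _ (by push_cast at he ⊢; omega), mul_zero, mul_zero]
  rcases n with n | m
  · change (ofPoly (Q.basicPoly n)).coeff e = 0
    rw [coeff_ofPoly]
    split_ifs
    · refine coeff_eq_zero_of_natDegree_lt ?_
      rw [(Q.basicPoly_spec n).1]
      simp at h
      omega
    · rfl
  · change (HahnSeries.single (-1) 1 * Q.negStar (m + 1)).coeff e = 0
    rw [coeff_X_mul]
    exact hneg _ _ (by push_cast; omega)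

theorem coeff_pStar_eq_zero {n e : ℤ} (h : n + e < 0) : (Q.pStar n).coeff e = 0 := by
  rw [pStar, coeff_X_inv_mul]
  exact Q.coeff_p_eq_zero (by omega)

end NormalizedDeltaOperator

/-! ### The shift in one variable -/

/-- The coefficient of `f(x + u)`, a polynomial in `u`, at the exponent `e` of `x⁻¹`. -/
noncomputable def shiftCoeff (f : LaurentSeries ℂ) (e : ℤ) : ℂ[X] :=
  ∑ᶠ j : ℕ, C (f.coeff (e - j) * ((Ring.choose ((j : ℤ) - e) j : ℤ) : ℂ)) * X ^ j

theorem shiftCoeff_eq {f : LaurentSeries ℂ} {e : ℤ} {M : ℕ}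
    (hM : ∀ k : ℕ, M ≤ k → f.coeff (e - k) = 0) :
    shiftCoeff f e = ∑ j ∈ Finset.range M,
      C (f.coeff (e - j) * ((Ring.choose ((j : ℤ) - e) j : ℤ) : ℂ)) * X ^ j := by
  refine finsum_eq_sum_of_support_subset _ fun k hk => ?_
  by_contra h
  exact hk (by simp only [hM k (by simpa using h), zero_mul, C_0])

namespace NormalizedDeltaOperator

variable (Q : NormalizedDeltaOperator)

/-- The Taylor expansion of a polynomial with respect to `Q`. -/
theorem eq_sum_basicPoly (n : ℕ) (f : ℂ[X]) (hf : f.degree < n) :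
    f = ∑ k ∈ Finset.range n, C ((Q.toLin^[k] f).eval 0 / k.factorial) * Q.basicPoly k := by
  induction n generalizing f with
  | zero =>
    rw [Finset.sum_range_zero, ← degree_eq_bot]
    exact (Nat.WithBot.lt_zero_iff).1 (by simpa using hf)
  | succ n ih =>
    have hQ : (Q.toLin f).degree < n := by
      rcases Nat.eq_zero_or_pos f.natDegree with h0 | hpos
      · rw [eq_C_of_natDegree_eq_zero h0, Q.map_C, degree_zero]
        exact WithBot.bot_lt_coe _
      · obtain ⟨m, hm⟩ : ∃ m, f.natDegree = m + 1 := ⟨f.natDegree - 1, by omega⟩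
        have hf0 : f ≠ 0 := by rintro rfl; simp at hm
        rw [degree_eq_natDegree hf0, hm] at hf
        rw [Q.degree_map f m (by rw [degree_eq_natDegree hf0, hm])]
        have : m + 1 < n + 1 := by exact_mod_cast hf
        exact_mod_cast (by omega : m < n)
    have h1 := ih _ hQ
    set g := ∑ k ∈ Finset.range (n + 1),
      C ((Q.toLin^[k] f).eval 0 / k.factorial) * Q.basicPoly k with hg
    have h2 : Q.toLin g = Q.toLin f := by
      rw [hg, map_sum, Finset.sum_range_succ']
      simp only [← smul_eq_C_mul, map_smul, map_basicPoly_succ]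
      rw [basicPoly_zero, ← C_1, Q.map_C, smul_zero, add_zero]
      conv_rhs => rw [h1]
      refine Finset.sum_congr rfl fun k _ => ?_
      rw [smul_smul, ← smul_eq_C_mul, Function.iterate_succ_apply, Nat.factorial_succ]
      congr 1
      have hk : ((k : ℂ) + 1) ≠ 0 := by exact_mod_cast k.succ_ne_zero
      have hk2 : (k.factorial : ℂ) ≠ 0 := by exact_mod_cast k.factorial_ne_zero
      push_cast
      field_simp
    have h3 := Q.eq_C_of_toLin_eq_zero (f := f - g) (by rw [map_sub, h2, sub_self])
    have h4 : (f - g).eval 0 = 0 := by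
      rw [eval_sub, hg, eval_finsetSum, Finset.sum_range_succ']
      simp [eval_basicPoly_succ, basicPoly_zero]
    rw [h4, C_0, sub_eq_zero] at h3
    exact h3

theorem psAct_pow_ofPoly (k : ℕ) (f : ℂ[X]) :
    psAct (Q.series ^ k) (ofPoly f) = ofPoly (Q.toLin^[k] f) := by
  induction k with
  | zero => rw [pow_zero, psAct_one, Function.iterate_zero, id]
  | succ k ih => rw [pow_succ', psAct_mul, ih, psAct_ofPoly, Function.iterate_succ_apply']

/-- The coefficients of `exp (u t) = ∑ p_k(u) Q(t) ^ k / k!`. -/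
theorem X_pow_eq_sum_basicPoly {m n : ℕ} (h : m < n) :
    (X : ℂ[X]) ^ m = ∑ k ∈ Finset.range n,
      C (m.factorial / k.factorial * PowerSeries.coeff m (Q.series ^ k)) * Q.basicPoly k := by
  conv_lhs => rw [Q.eq_sum_basicPoly n (X ^ m) (by rw [degree_X_pow]; exact_mod_cast h)]
  refine Finset.sum_congr rfl fun k _ => ?_
  have h1 : (Q.toLin^[k] (X ^ m)).eval 0 = (ofPoly (Q.toLin^[k] (X ^ m))).coeff 0 := by
    rw [coeff_ofPoly]
    simp [coeff_zero_eq_eval_zero]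
  have h2 : iterCoeff 0 m = m.factorial := by
    rw [← factorial_mul_choose, sub_zero, Ring.choose_natCast]
    simp
  rw [h1, ← psAct_pow_ofPoly, coeff_psAct _ (M := m + 1) fun j hj => by
    rw [coeff_ofPoly, if_pos (by omega), coeff_X_pow, if_neg (by omega)],
    Finset.sum_eq_single m]
  · rw [coeff_ofPoly, if_pos (by omega), coeff_X_pow, if_pos (by omega), h2]
    congr 2
    ring
  · intro j _ hj
    rw [coeff_ofPoly, if_pos (by omega), coeff_X_pow, if_neg (by omega), mul_zero, mul_zero]
  · simp

/-- The shift by `u` is `∑ p_k(u) Q ^ k / k!`. -/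
theorem shiftCoeff_eq_sum_psAct {f : LaurentSeries ℂ} {e : ℤ} {M : ℕ}
    (hM : ∀ k : ℕ, M ≤ k → f.coeff (e - k) = 0) :
    shiftCoeff f e = ∑ k ∈ Finset.range M,
      C ((psAct (Q.series ^ k) f).coeff e / k.factorial) * Q.basicPoly k := by
  rw [shiftCoeff_eq hM]
  simp only [coeff_psAct _ hM, Finset.sum_div, map_sum, Finset.sum_mul]
  rw [Finset.sum_comm]
  refine Finset.sum_congr rfl fun j hj => ?_
  conv_lhs => rw [Q.X_pow_eq_sum_basicPoly (Finset.mem_range.1 hj), Finset.mul_sum]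
  refine Finset.sum_congr rfl fun k _ => ?_
  rw [← mul_assoc, ← C_mul, ← factorial_mul_choose]
  congr 2
  ring

end NormalizedDeltaOperator

/-- The expansion `f_n(x + u) = ∑ binom(n, k) q_k(u) g_{n-k}(x)`, read off at each power of `x`;
the members `g_n` have no powers of `x` beyond `x ^ n`, so all the sums are finite. -/
structure BinomialShift (f g : ℤ → LaurentSeries ℂ) (q : ℕ → ℂ[X]) : Prop where
  coeff_eq_zero : ∀ n e : ℤ, n + e < 0 → (g n).coeff e = 0
  shiftCoeff_eq : ∀ (n e : ℤ) (M : ℕ), n + e < M → shiftCoeff (f n) e = ∑ k ∈ Finset.range M,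
    C (((Ring.choose n k : ℤ) : ℂ) * (g (n - k)).coeff e) * q k

namespace NormalizedDeltaOperator

variable (Q : NormalizedDeltaOperator)

theorem binomialShift_of_psAct {f : ℤ → LaurentSeries ℂ}
    (hf : ∀ n e : ℤ, n + e < 0 → (f n).coeff e = 0)
    (hQ : ∀ n, psAct Q.series (f n) = (n : ℂ) • f (n - 1)) :
    BinomialShift f f Q.basicPoly := by
  refine ⟨hf, fun n e M hM => ?_⟩
  have hpow : ∀ k : ℕ, psAct (Q.series ^ k) (f n) =
      ((k.factorial : ℂ) * ((Ring.choose n k : ℤ) : ℂ)) • f (n - k) := by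
    intro k
    have hk : (k.factorial : ℂ) * ((Ring.choose n k : ℤ) : ℂ) = iterCoeff (k - n) k := by
      rw [← factorial_mul_choose, sub_sub_cancel]
    rw [hk]
    have hk' : iterCoeff (k - n) k = ∏ i ∈ Finset.range k, ((n : ℂ) - i) := by
      rw [iterCoeff, ← Finset.prod_range_reflect]
      refine Finset.prod_congr rfl fun i hi => ?_
      have hi := Finset.mem_range.1 hi
      rw [Nat.cast_sub (by omega), Nat.cast_sub (by omega)]
      push_cast
      ring
    rw [hk']
    clear hk hk'
    induction k with
    | zero => rw [pow_zero, psAct_one]; ext; simp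
    | succ k ih =>
      rw [pow_succ', psAct_mul, ih, psAct_smul, hQ, smul_smul, Finset.prod_range_succ]
      push_cast
      rw [sub_sub]
  rw [Q.shiftCoeff_eq_sum_psAct (M := M) fun k hk => hf _ _ (by omega)]
  refine Finset.sum_congr rfl fun k _ => ?_
  have hk2 : (k.factorial : ℂ) ≠ 0 := by exact_mod_cast k.factorial_ne_zero
  rw [hpow, HahnSeries.coeff_smul, smul_eq_mul]
  congr 2
  field_simp

theorem binomialShift_p : BinomialShift Q.p Q.p Q.basicPoly :=
  Q.binomialShift_of_psAct (fun _ _ => Q.coeff_p_eq_zero) Q.psAct_p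

theorem binomialShift_pStar : BinomialShift Q.pStar Q.pStar Q.basicPoly :=
  Q.binomialShift_of_psAct (fun _ _ => Q.coeff_pStar_eq_zero) Q.psAct_pStar

theorem X_mul_basicPolyStar (n : ℕ) : X * Q.basicPolyStar n = Q.basicPoly (n + 1) := by
  conv_rhs => rw [← X_mul_divX_add (Q.basicPoly (n + 1))]
  rw [coeff_zero_eq_eval_zero, eval_basicPoly_succ, C_0, add_zero, basicPolyStar]

end NormalizedDeltaOperator

/-- `(x f)(x + u) = (x + u) f(x + u)`. -/
theorem shiftCoeff_X_mul (f : LaurentSeries ℂ) (e : ℤ) :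
    shiftCoeff (HahnSeries.single (-1) 1 * f) e =
      shiftCoeff f (e + 1) + X * shiftCoeff f e := by
  obtain ⟨M, hM⟩ := exists_coeff_sub_eq_zero f e
  have h1 : ∀ k : ℕ, M + 1 ≤ k → f.coeff (e + 1 - k) = 0 := fun k hk => by
    have := hM (k - 1) (by omega)
    rwa [Nat.cast_sub (by omega), Nat.cast_one, show e - ((k : ℤ) - 1) = e + 1 - k by ring] at this
  rw [shiftCoeff_eq hM, shiftCoeff_eq h1, shiftCoeff_eq (M := M + 1) fun k hk => by
    rw [coeff_X_mul, show e - (k : ℤ) + 1 = e + 1 - k by ring, h1 k hk],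
    Finset.sum_range_succ', Finset.sum_range_succ' (n := M), Finset.mul_sum, add_right_comm,
    ← Finset.sum_add_distrib]
  congr 1
  · refine Finset.sum_congr rfl fun k _ => ?_
    have e1 : e - ((k + 1 : ℕ) : ℤ) + 1 = e - k := by push_cast; ring
    have e2 : e + 1 - ((k + 1 : ℕ) : ℤ) = e - k := by push_cast; ring
    have e3 : ((k + 1 : ℕ) : ℤ) - e = (k - e) + 1 := by push_cast; ring
    have e4 : ((k + 1 : ℕ) : ℤ) - (e + 1) = k - e := by push_cast; ring
    rw [coeff_X_mul, e1, e2, e3, e4, Ring.choose_succ_succ]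
    push_cast
    simp only [C_mul, C_add]
    ring
  · simp [coeff_X_mul]

namespace NormalizedDeltaOperator

variable (Q : NormalizedDeltaOperator)

/-- The expansion of `p*_n(x + u)` in the `p_k(x)`: subtract `x p*_n(x + u)` from
`(x + u) p*_n(x + u) = p_{n+1}(x + u)`, apply Pascal's rule and cancel `u`. -/
theorem binomialShift_pStar_p : BinomialShift Q.pStar Q.p Q.basicPolyStar := by
  refine ⟨fun _ _ => Q.coeff_p_eq_zero, fun n e M hM => ?_⟩
  have h := shiftCoeff_X_mul (Q.pStar n) e
  rw [X_mul_pStar, Q.binomialShift_p.shiftCoeff_eq (n + 1) e (M + 1) (by push_cast; omega),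
    Q.binomialShift_pStar.shiftCoeff_eq n (e + 1) (M + 1) (by push_cast; omega),
    Finset.sum_range_succ', Finset.sum_range_succ' (n := M)] at h
  have h0 : ∀ k : ℤ, (Q.pStar k).coeff (e + 1) = (Q.p (k + 1)).coeff e := fun k => by
    rw [← X_mul_pStar, coeff_X_mul]
  simp only [h0, Ring.choose_zero_right, Nat.cast_zero, sub_zero, add_right_comm _ _ (X * _),
    add_left_inj] at h
  refine mul_left_cancel₀ (X_ne_zero (R := ℂ)) ?_
  rw [← sub_eq_iff_eq_add'] at h
  rw [← h, ← Finset.sum_sub_distrib, Finset.mul_sum]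
  refine Finset.sum_congr rfl fun k _ => ?_
  have e1 : n + 1 - ((k + 1 : ℕ) : ℤ) = n - k := by push_cast; ring
  have e2 : n - ((k + 1 : ℕ) : ℤ) + 1 = n - k := by push_cast; ring
  rw [e1, e2, Ring.choose_succ_succ, ← X_mul_basicPolyStar]
  push_cast
  simp only [C_mul, C_add]
  ring

end NormalizedDeltaOperator

/-! ### Determinants -/

/-- A determinant with a zero block of `N - j` rows and `j + 1` columns vanishes. -/
theorem det_eq_zero_of_block {N : ℕ} {R : Type*} [CommRing R] (M : Matrix (Fin N) (Fin N) R)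
    (j : Fin N) (h : ∀ i k, j ≤ i → k ≤ j → M i k = 0) : M.det = 0 := by
  rw [Matrix.det_apply']
  refine Finset.sum_eq_zero fun σ _ => ?_
  obtain ⟨k, hk, hσ⟩ : ∃ k ≤ j, j ≤ σ k := by
    by_contra! hc
    have h1 := Finset.card_le_card_of_injOn (s := Finset.Iic j) (t := Finset.Iio j) σ
      (fun k hk => by simpa using hc k (by simpa using hk)) σ.injective.injOn
    simp at h1
  exact mul_eq_zero_of_right _ (Finset.prod_eq_zero (Finset.mem_univ k) (h _ _ hσ hk))

/-- The uniqueness of the sorting of an injective map. -/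
theorem strictAnti_comp_perm_injective {N : ℕ} {s t : Fin N → ℤ} (hs : StrictAnti s)
    (ht : StrictAnti t) {σ τ : Equiv.Perm (Fin N)} (h : s ∘ σ = t ∘ τ) : s = t ∧ σ = τ := by
  have hst : s = t := by
    have h1 : Set.range s = Set.range t := by
      rw [← σ.surjective.range_comp s, h, τ.surjective.range_comp]
    have h2 : Set.range (s ∘ Fin.rev) = Set.range (t ∘ Fin.rev) := by
      rw [Fin.rev_surjective.range_comp, Fin.rev_surjective.range_comp, h1]
    have h3 := (StrictMono.range_inj (hs.comp Fin.rev_strictAnti)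
      (ht.comp Fin.rev_strictAnti)).1 h2
    funext i
    simpa using congrFun h3 i.rev
  refine ⟨hst, ?_⟩
  subst hst
  ext1 i
  exact hs.injective (congrFun h i)

theorem exists_strictAnti_comp_perm {N : ℕ} {h : Fin N → ℤ} (hh : Function.Injective h) :
    ∃ (s : Fin N → ℤ) (σ : Equiv.Perm (Fin N)), StrictAnti s ∧ s ∘ σ = h := by
  set τ := Tuple.sort (fun i => -h i) with hτ
  have hm := Tuple.monotone_sort (fun i => -h i)
  rw [← hτ] at hm
  refine ⟨h ∘ τ, τ⁻¹, ?_, ?_⟩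
  · have ha : Antitone (h ∘ τ) := fun i j hij => by
      have := hm hij
      simpa using this
    exact ha.strictAnti_of_injective (hh.comp τ.injective)
  · funext i
    simp

/-- The Cauchy–Binet formula, with the columns and rows indexed by a finite set of integers. -/
theorem det_sum_mul {N : ℕ} {R : Type*} [CommRing R] (A : Fin N → ℤ → R) (B : ℤ → Fin N → R)
    (T : Finset ℤ) :
    (Matrix.of fun i j => ∑ m ∈ T, A i m * B m j).det =
      ∑ s ∈ (Fintype.piFinset fun _ : Fin N => T) with StrictAnti s,
        (Matrix.of fun i j => A i (s j)).det * (Matrix.of fun i j => B (s i) j).det := by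
  classical
  have h1 : (Matrix.of fun i j => ∑ m ∈ T, A i m * B m j).det =
      ∑ h ∈ Fintype.piFinset fun _ : Fin N => T,
        (∏ i, A i (h i)) * (Matrix.of fun i j => B (h i) j).det := by
    have h2 : (Matrix.of fun i j => ∑ m ∈ T, A i m * B m j) =
        fun i => ∑ m ∈ T, A i m • B m := by
      ext i j
      simp [Finset.sum_apply]
    rw [h2]
    change Matrix.detRowAlternating.toMultilinearMap _ = _
    rw [MultilinearMap.map_sum_finset]
    refine Finset.sum_congr rfl fun h _ => ?_
    rw [MultilinearMap.map_smul_univ]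
    rfl
  rw [h1]
  have h3 : ∀ s : Fin N → ℤ,
      (Matrix.of fun i j => A i (s j)).det * (Matrix.of fun i j => B (s i) j).det =
      ∑ σ : Equiv.Perm (Fin N), (∏ i, A i ((s ∘ σ) i)) *
        (Matrix.of fun i j => B ((s ∘ σ) i) j).det := by
    intro s
    rw [← Matrix.det_transpose (Matrix.of fun i j => A i (s j)), Matrix.det_apply', Finset.sum_mul]
    refine Finset.sum_congr rfl fun σ _ => ?_
    have : (Matrix.of fun i j => B ((s ∘ σ) i) j) =
        (Matrix.of fun i j => B (s i) j).submatrix σ id := rfl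
    rw [this, Matrix.det_permute]
    simp only [Matrix.transpose_apply, Matrix.of_apply, Function.comp]
    ring
  simp only [h3]
  rw [← Finset.sum_product']
  symm
  refine Finset.sum_bij_ne_zero (fun x _ _ => x.1 ∘ x.2) ?_ ?_ ?_ ?_
  · rintro ⟨s, σ⟩ hx _
    simp only [Finset.mem_product, Finset.mem_filter, Fintype.mem_piFinset] at hx ⊢
    exact fun i => hx.1.1 _
  · rintro ⟨s, σ⟩ hs _ ⟨t, τ⟩ ht _ h
    simp only [Finset.mem_product, Finset.mem_filter] at hs ht
    obtain ⟨rfl, rfl⟩ := strictAnti_comp_perm_injective hs.1.2 ht.1.2 h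
    rfl
  · intro h hh hne
    have hinj : Function.Injective h := by
      intro i k hik
      by_contra hne'
      refine hne ?_
      rw [Matrix.det_zero_of_row_eq hne' (by ext j; simp [hik]), mul_zero]
    obtain ⟨s, σ, hs, rfl⟩ := exists_strictAnti_comp_perm hinj
    refine ⟨(s, σ), ?_, hne, rfl⟩
    simp only [Finset.mem_product, Finset.mem_filter, Fintype.mem_piFinset, Finset.mem_univ,
      and_true] at hh ⊢
    refine ⟨fun i => ?_, hs⟩
    simpa using hh (σ.symm i)
  · intro _ _ _
    rfl

/-! ### Coefficients of alternants -/

theorem coeff_atVar_mul {N : ℕ} (j : Fin N) (f : LaurentSeries ℂ) (G : MultiLaurent N ℂ)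
    (hG : ∀ e : Fin N → ℤ, e j ≠ 0 → G.coeff e = 0) (e : Fin N → ℤ) :
    (atVar j f * G).coeff e = f.coeff (e j) * G.coeff (Function.update e j 0) := by
  have h1 : ∀ a : Fin N → ℤ, (atVar j f).coeff a ≠ 0 → a = Pi.single j (a j) := by
    intro a ha
    by_contra h
    refine ha (HahnSeries.embDomain_of_notMem_range ?_)
    rintro ⟨k, rfl⟩
    exact h (by simp)
  have h2 : ∀ k : ℤ, (atVar j f).coeff (Pi.single j k) = f.coeff k := fun k =>
    HahnSeries.embDomain_coeff
  have hsplit : Pi.single j (e j) + Function.update e j 0 = e := by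
    funext i
    by_cases hi : i = j
    · subst hi; simp
    · simp [hi]
  rw [HahnSeries.coeff_mul, Finset.sum_eq_single (Pi.single j (e j), Function.update e j 0)]
  · simp only [h2]
  · rintro ⟨a, b⟩ hab hne
    simp only [Finset.mem_antidiagonal, HahnSeries.mem_support] at hab
    exfalso
    have hb : b j = 0 := by
      by_contra hb
      exact hab.2.1 (hG b hb)
    have ha := h1 a hab.1
    have haj : a j = e j := by
      have := congrFun hab.2.2 j
      simpa [hb] using this
    rw [haj] at ha
    refine hne ?_
    rw [Prod.mk.injEq]
    refine ⟨ha, ?_⟩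
    have h3 := hab.2.2
    rw [ha] at h3
    exact add_left_cancel (h3.trans hsplit.symm)
  · intro h
    by_contra hne
    refine h ?_
    simp only [Finset.mem_antidiagonal, HahnSeries.mem_support]
    exact ⟨left_ne_zero_of_mul hne, right_ne_zero_of_mul hne, hsplit⟩

theorem coeff_prod_atVar {N : ℕ} (f : Fin N → LaurentSeries ℂ) (S : Finset (Fin N))
    (e : Fin N → ℤ) : (∏ j ∈ S, atVar j (f j)).coeff e =
      if ∀ i ∉ S, e i = 0 then ∏ j ∈ S, (f j).coeff (e j) else 0 := by
  induction S using Finset.induction_on generalizing e with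
  | empty =>
    rw [Finset.prod_empty, Finset.prod_empty, HahnSeries.coeff_one]
    simp [funext_iff]
  | insert j S hj ih =>
    have hG : ∀ e : Fin N → ℤ, e j ≠ 0 → (∏ j ∈ S, atVar j (f j)).coeff e = 0 := fun e he => by
      rw [ih, if_neg fun h => he (h j hj)]
    rw [Finset.prod_insert hj, coeff_atVar_mul j _ _ hG, ih, Finset.prod_insert hj, mul_ite,
      mul_zero]
    have hiff : (∀ i ∉ S, Function.update e j 0 i = 0) ↔ ∀ i ∉ insert j S, e i = 0 := by
      constructor
      · intro h i hi
        rw [Finset.mem_insert, not_or] at hi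
        simpa [hi.1] using h i hi.2
      · intro h i hi
        by_cases hij : i = j
        · simp [hij]
        · simpa [hij] using h i (by simp [hij, hi])
    simp only [hiff]
    congr 2
    refine Finset.prod_congr rfl fun i hi => ?_
    rw [Function.update_of_ne (by rintro rfl; exact hj hi)]

theorem coeff_alternant {N : ℕ} (f : Fin N → LaurentSeries ℂ) (e : Fin N → ℤ) :
    (alternant f).coeff e = (Matrix.of fun i j => (f i).coeff (e j)).det := by
  rw [alternant, Matrix.det_apply, Matrix.det_apply, HahnSeries.coeff_sum]
  refine Finset.sum_congr rfl fun σ _ => ?_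
  have h := coeff_prod_atVar (fun j => f (σ j)) Finset.univ e
  rw [if_pos (by simp)] at h
  rcases Int.units_eq_one_or (Equiv.Perm.sign σ) with hs | hs <;> rw [hs]
  · simpa using h
  · simpa using h

theorem bddBelow_support {N : ℕ} {R : Type*} [Zero R] (F : MultiLaurent N R) :
    ∃ b : Fin N → ℤ, ∀ e, F.coeff e ≠ 0 → b ≤ e := by
  have h : ∀ i : Fin N, ∃ b : ℤ, ∀ e, F.coeff e ≠ 0 → b ≤ e i := by
    intro i
    have h1 := F.isPWO_support.image_of_monotone (f := fun e : Fin N → ℤ => e i)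
      fun a b hab => hab i
    by_cases hne : ((fun e : Fin N → ℤ => e i) '' F.support).Nonempty
    · refine ⟨h1.isWF.min hne, fun e he => ?_⟩
      exact Set.IsWF.min_le _ _ ⟨e, he, rfl⟩
    · refine ⟨0, fun e he => absurd ⟨e i, ⟨e, he, rfl⟩⟩ hne⟩
  choose b hb using h
  exact ⟨b, fun e he i => hb i e he⟩

theorem exists_coeff_sub_natCast_eq_zero {N : ℕ} {R : Type*} [Zero R] (F : MultiLaurent N R)
    (e : Fin N → ℤ) :
    ∃ M : ℕ, ∀ j : Fin N → ℕ, (∃ i, M ≤ j i) → F.coeff (fun i => e i - j i) = 0 := by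
  obtain ⟨b, hb⟩ := bddBelow_support F
  refine ⟨∑ i, (e i - b i + 1).toNat, fun j ⟨i, hi⟩ => ?_⟩
  by_contra h
  have h1 := hb _ h i
  have h2 := Finset.single_le_sum (f := fun i => (e i - b i + 1).toNat) (fun _ _ => Nat.zero_le _)
    (Finset.mem_univ i)
  simp only at h1 h2
  omega

theorem coeff_shift {N : ℕ} {F : MultiLaurent N ℂ} {e : Fin N → ℤ} {M : ℕ}
    (hM : ∀ j : Fin N → ℕ, (∃ i, M ≤ j i) → F.coeff (fun i => e i - j i) = 0) :
    (shift F).coeff e = ∑ j ∈ Fintype.piFinset fun _ : Fin N => Finset.range M,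
      C (F.coeff (fun i => e i - j i) * ∏ i, ((Ring.choose ((j i : ℤ) - e i) (j i) : ℤ) : ℂ)) *
        X ^ (∑ i, j i) := by
  refine finsum_eq_sum_of_support_subset _ fun j hj => ?_
  by_contra h
  refine hj ?_
  have h1 : ∃ i, M ≤ j i := by simpa using h
  simp only [hM j h1, zero_mul, C_0]

/-- The shift acts on an alternant variable by variable, since each term of the determinant is a
product of series in distinct variables. -/
theorem coeff_shift_alternant {N : ℕ} (f : Fin N → LaurentSeries ℂ) (e : Fin N → ℤ) :
    (shift (alternant f)).coeff e = (Matrix.of fun i j => shiftCoeff (f i) (e j)).det := by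
  choose M hM using fun i j => exists_coeff_sub_eq_zero (f i) (e j)
  set K := ∑ i, ∑ j, M i j with hK
  have hle : ∀ i j, M i j ≤ K := fun i j =>
    (Finset.single_le_sum (f := fun j => M i j) (fun _ _ => Nat.zero_le _)
      (Finset.mem_univ j)).trans
    (Finset.single_le_sum (f := fun i => ∑ j, M i j) (fun _ _ => Nat.zero_le _)
      (Finset.mem_univ i))
  have hK : ∀ i j, ∀ k : ℕ, K ≤ k → (f i).coeff (e j - k) = 0 := fun i j k hk =>
    hM i j k ((hle i j).trans hk)
  rw [coeff_shift (M := K)]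
  · simp only [coeff_alternant, Matrix.det_apply', Finset.sum_mul, map_sum, Matrix.of_apply]
    rw [Finset.sum_comm]
    refine Finset.sum_congr rfl fun σ _ => ?_
    simp only [shiftCoeff_eq (hK _ _), Finset.prod_univ_sum, Finset.mul_sum]
    refine Finset.sum_congr rfl fun j _ => ?_
    simp only [Finset.prod_mul_distrib, C_mul, map_prod, Finset.prod_pow_eq_pow_sum, map_intCast]
    ring
  · rintro j ⟨i, hi⟩
    rw [coeff_alternant]
    exact Matrix.det_eq_zero_of_column_eq_zero i fun l => hK l i _ hi

/-! ### The expansion of the shifted alternants -/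

section ShiftDet

variable {N : ℕ}

/-- The strictly decreasing exponents `λ_i + N - i` of the alternant attached to `λ`. -/
def shiftedParts (lam : Fin N → ℤ) (i : Fin N) : ℤ := lam i + N - (i + 1)

theorem shiftedParts_strictAnti {mu : Fin N → ℤ} (h : Antitone mu) :
    StrictAnti (shiftedParts mu) := by
  intro i j hij
  have h1 := h hij.le
  have h2 : (i : ℕ) < j := hij
  simp only [shiftedParts]
  omega

theorem exists_shiftedParts_eq {s : Fin N → ℤ} (hs : StrictAnti s) :
    ∃ mu : Fin N → ℤ, Antitone mu ∧ shiftedParts mu = s := by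
  refine ⟨fun i => s i - N + (i + 1), ?_, ?_⟩
  · rcases N with _ | N
    · exact fun i => i.elim0
    · rw [Fin.antitone_iff_succ_le]
      intro i
      have := hs (Fin.castSucc_lt_succ (i := i))
      simp only [Fin.val_succ, Fin.val_castSucc]
      push_cast
      omega
  · funext i
    simp only [shiftedParts]
    ring

theorem shiftedParts_injective : Function.Injective (shiftedParts (N := N)) := by
  intro a b h
  funext i
  have := congrFun h i
  simp only [shiftedParts] at this
  omega

/-- The determinant `det (binom(λ_i + N - i, λ_i - μ_j - i + j) q_{λ_i - μ_j - i + j}(u))`. -/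
noncomputable def shiftDet (q : ℕ → ℂ[X]) (lam mu : Fin N → ℤ) : ℂ[X] :=
  (Matrix.of fun i j : Fin N =>
    ((intChoose (lam i + N - (i + 1)) (lam i - mu j - i + j) : ℤ) : ℂ[X]) *
      q (lam i - mu j - i + j).toNat).det

/-- If `μ_j > λ_j`, the entries with row `≥ j` and column `≤ j` have a negative lower index. -/
theorem shiftDet_eq_zero (q : ℕ → ℂ[X]) {lam mu : Fin N → ℤ} (hlam : Antitone lam)
    (hmu : Antitone mu) (h : ¬ mu ≤ lam) : shiftDet q lam mu = 0 := by
  obtain ⟨j, hj⟩ : ∃ j, lam j < mu j := by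
    simpa [Pi.le_def] using h
  refine det_eq_zero_of_block _ j fun i k hi hk => ?_
  have h1 := hlam hi
  have h2 := hmu hk
  have h3 : (j : ℕ) ≤ i := hi
  have h4 : (k : ℕ) ≤ j := hk
  rw [Matrix.of_apply, intChoose, if_neg (by omega), Int.cast_zero, zero_mul]

theorem exists_coeff_ne_zero_of_coeff_alternant {f : Fin N → LaurentSeries ℂ} {e : Fin N → ℤ}
    (h : (alternant f).coeff e ≠ 0) (i : Fin N) : ∃ j, (f i).coeff (e j) ≠ 0 := by
  rw [coeff_alternant] at h
  by_contra! hc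
  exact h (Matrix.det_eq_zero_of_row_eq_zero i hc)

/-- The coefficients of the expansion of a shifted alternant: the Cauchy–Binet formula applied to
the one-variable expansions. -/
theorem BinomialShift.coeff_shift_alternant {f g : ℤ → LaurentSeries ℂ} {q : ℕ → ℂ[X]}
    (H : BinomialShift f g q) {lam : Fin N → ℤ} (hlam : Antitone lam) (e : Fin N → ℤ) :
    (shift (alternant fun i => f (shiftedParts lam i))).coeff e =
      ∑ᶠ mu : {mu : Fin N → ℤ // Antitone mu ∧ mu ≤ lam},
        shiftDet q lam mu * C ((alternant fun i => g (shiftedParts mu i)).coeff e) := by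
  set l := shiftedParts lam with hl
  -- only the rows `g_m` with `-K ≤ m ≤ K` contribute to the coefficient at `e`
  set K : ℤ := ∑ i, |l i| + ∑ j, |e j| with hK
  have hlK : ∀ i, |l i| + ∑ j, |e j| ≤ K := fun i => by
    have := Finset.single_le_sum (f := fun i => |l i|) (fun _ _ => abs_nonneg _)
      (Finset.mem_univ i)
    omega
  have heK : ∀ j, |e j| ≤ ∑ j, |e j| := fun j =>
    Finset.single_le_sum (f := fun i => |e i|) (fun _ _ => abs_nonneg _) (Finset.mem_univ j)
  have heK0 : 0 ≤ ∑ j, |e j| := Finset.sum_nonneg fun _ _ => abs_nonneg _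
  have hl1 : ∀ i, -K ≤ l i ∧ l i ≤ K := fun i => by
    have := hlK i
    have := abs_le.1 (le_refl |l i|)
    omega
  set A : Fin N → ℤ → ℂ[X] := fun i m =>
    ((intChoose (l i) (l i - m) : ℤ) : ℂ[X]) * q (l i - m).toNat with hA
  set B : ℤ → Fin N → ℂ[X] := fun m j => C ((g m).coeff (e j)) with hB
  have hrow : ∀ i j, shiftCoeff (f (l i)) (e j) = ∑ m ∈ Finset.Icc (-K) K, A i m * B m j := by
    intro i j
    have h1 := hl1 i
    have h2 : e j ≤ K := by
      have := heK j
      have := hlK i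
      have := le_abs_self (e j)
      have := abs_nonneg (l i)
      omega
    rw [H.shiftCoeff_eq (l i) (e j) (l i + K + 1).toNat (by omega)]
    refine Finset.sum_bij_ne_zero (fun k _ _ => l i - k) ?_ ?_ ?_ ?_
    · intro k hk _
      have := Finset.mem_range.1 hk
      rw [Finset.mem_Icc]
      omega
    · intro k _ _ k' _ _ h
      omega
    · intro m hm hne
      have hm := Finset.mem_Icc.1 hm
      have hml : 0 ≤ l i - m := by
        by_contra h
        refine hne ?_
        simp only [hA, intChoose, if_neg h, Int.cast_zero, zero_mul]
      refine ⟨(l i - m).toNat, Finset.mem_range.2 (by omega), ?_, by omega⟩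
      convert hne using 1
      simp only [hA, hB, intChoose, if_pos hml, Int.toNat_of_nonneg hml, sub_sub_cancel, C_mul,
        map_intCast]
      ring
    · intro k hk _
      simp only [hA, hB, intChoose, sub_sub_cancel, Int.toNat_natCast, C_mul, map_intCast,
        if_pos (Int.natCast_nonneg k)]
      ring
  rw [SchurType.coeff_shift_alternant]
  simp only [hrow]
  rw [det_sum_mul]
  let t : (Fin N → ℤ) → ℂ[X] := fun s =>
    (Matrix.of fun i j => A i (s j)).det * (Matrix.of fun i j => B (s i) j).det
  have hterm : ∀ mu : Fin N → ℤ,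
      shiftDet q lam mu * C ((alternant fun i => g (shiftedParts mu i)).coeff e) =
        t (shiftedParts mu) := by
    intro mu
    refine congrArg₂ (· * ·) ?_ ?_
    · rw [shiftDet]
      congr 1
      ext1 i j
      have : l i - shiftedParts mu j = lam i - mu j - i + j := by
        simp only [hl, shiftedParts]
        ring
      simp only [Matrix.of_apply, hA, this]
      rfl
    · rw [coeff_alternant, RingHom.map_det]
      rfl
  have hinj : Function.Injective
      fun mu : {mu : Fin N → ℤ // Antitone mu ∧ mu ≤ lam} => shiftedParts mu.1 :=
    fun a b h => Subtype.ext (shiftedParts_injective h)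
  have hfin : (∑ᶠ mu : {mu : Fin N → ℤ // Antitone mu ∧ mu ≤ lam},
      shiftDet q lam mu * C ((alternant fun i => g (shiftedParts mu i)).coeff e)) =
      ∑ᶠ mu : {mu : Fin N → ℤ // Antitone mu ∧ mu ≤ lam}, t (shiftedParts mu.1) :=
    finsum_congr fun mu => hterm mu
  rw [hfin, ← finsum_mem_range (f := t) hinj]
  symm
  refine finsum_mem_eq_sum_of_inter_support_eq t ?_
  ext s
  simp only [Set.mem_inter_iff, Set.mem_range, Function.mem_support, Finset.coe_filter,
    Fintype.mem_piFinset, Finset.mem_Icc, Set.mem_ofPred_eq, and_congr_left_iff]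
  intro hs
  constructor
  · rintro ⟨⟨mu, hmu, hle⟩, rfl⟩
    refine ⟨fun i => ?_, shiftedParts_strictAnti hmu⟩
    have h1 := right_ne_zero_of_mul ((hterm mu).trans_ne hs)
    obtain ⟨j, hj⟩ := exists_coeff_ne_zero_of_coeff_alternant (fun h => h1 (by rw [h, C_0])) i
    have h2 : 0 ≤ shiftedParts mu i + e j := by
      by_contra h
      exact hj (H.coeff_eq_zero _ _ (by omega))
    have h3 := heK j
    have h4 := le_abs_self (e j)
    have h5 := hlK i
    have h6 := abs_nonneg (l i)
    have h7 : shiftedParts mu i ≤ l i := by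
      have : mu i ≤ lam i := hle i
      simp only [hl, shiftedParts]
      omega
    have h8 := hl1 i
    constructor <;> simp only <;> omega
  · rintro ⟨-, hanti⟩
    obtain ⟨mu, hmu, rfl⟩ := exists_shiftedParts_eq hanti
    refine ⟨⟨mu, hmu, ?_⟩, rfl⟩
    by_contra h
    refine hs ?_
    rw [← hterm, shiftDet_eq_zero q hlam hmu h, zero_mul]

end ShiftDet

/-! ### The shift of a multiple of the Vandermonde determinant -/

section Vandermonde

variable {N : ℕ}

theorem constInU_mul (f g : MultiLaurent N ℂ) : constInU (f * g) = constInU f * constInU g :=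
  HahnSeries.map_mul ((C : ℂ →+* ℂ[X]) : ℂ →ₙ+* ℂ[X])

theorem constInU_sub (f g : MultiLaurent N ℂ) : constInU (f - g) = constInU f - constInU g := by
  ext1
  funext e
  exact map_sub C _ _

theorem constInU_one : constInU (1 : MultiLaurent N ℂ) = 1 :=
  HahnSeries.map_one (C : ℂ →+* ℂ[X]).toMonoidWithZeroHom

theorem coeff_xVar_mul (a : Fin N) (F : MultiLaurent N ℂ) (e : Fin N → ℤ) :
    (xVar a * F).coeff e = F.coeff (e + Pi.single a 1) := by
  rw [xVar, HahnSeries.coeff_single_mul, one_mul, sub_neg_eq_add]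

theorem coeff_constInU_xVar_mul (a : Fin N) (F : MultiLaurent N ℂ[X]) (e : Fin N → ℤ) :
    (constInU (xVar a) * F).coeff e = F.coeff (e + Pi.single a 1) := by
  have h : constInU (xVar a) = HahnSeries.single (-Pi.single a 1) 1 := by
    ext1
    funext e
    change C ((HahnSeries.single (-Pi.single a 1) (1 : ℂ)).coeff e) = _
    rw [HahnSeries.coeff_single, HahnSeries.coeff_single]
    split_ifs <;> simp
  rw [h, HahnSeries.coeff_single_mul, one_mul, sub_neg_eq_add]

theorem shift_sub (F G : MultiLaurent N ℂ) : shift (F - G) = shift F - shift G := by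
  ext1
  funext e
  obtain ⟨M, hM⟩ := exists_coeff_sub_natCast_eq_zero F e
  obtain ⟨M', hM'⟩ := exists_coeff_sub_natCast_eq_zero G e
  have h1 : ∀ j : Fin N → ℕ, (∃ i, M + M' ≤ j i) → F.coeff (fun i => e i - j i) = 0 :=
    fun j ⟨i, hi⟩ => hM j ⟨i, by omega⟩
  have h2 : ∀ j : Fin N → ℕ, (∃ i, M + M' ≤ j i) → G.coeff (fun i => e i - j i) = 0 :=
    fun j ⟨i, hi⟩ => hM' j ⟨i, by omega⟩
  rw [HahnSeries.coeff_sub, coeff_shift h1, coeff_shift h2, coeff_shift (M := M + M') fun j hj => by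
    rw [HahnSeries.coeff_sub, h1 j hj, h2 j hj, sub_zero], ← Finset.sum_sub_distrib]
  refine Finset.sum_congr rfl fun j _ => ?_
  rw [HahnSeries.coeff_sub, sub_mul, C_sub, sub_mul]

/-- `(x_a F)(x_1 + u, …) = (x_a + u) F(x_1 + u, …)`, by Pascal's rule. -/
theorem shift_xVar_mul (a : Fin N) (F : MultiLaurent N ℂ) :
    shift (xVar a * F) = constInU (xVar a) * shift F + HahnSeries.C (X : ℂ[X]) * shift F := by
  ext1
  funext e
  obtain ⟨M, hM⟩ := exists_coeff_sub_natCast_eq_zero F e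
  obtain ⟨M', hM'⟩ := exists_coeff_sub_natCast_eq_zero F (e + Pi.single a 1)
  set K := M + M' + 1 with hK
  have hF : ∀ j : Fin N → ℕ, (xVar a * F).coeff (fun i => e i - j i) =
      F.coeff (fun i => (e + Pi.single a 1 : Fin N → ℤ) i - j i) := fun j => by
    rw [coeff_xVar_mul]
    congr 1
    funext i
    simp only [Pi.add_apply]
    ring
  have h1 : ∀ j : Fin N → ℕ, (∃ i, K ≤ j i) → F.coeff (fun i => e i - j i) = 0 :=
    fun j ⟨i, hi⟩ => hM j ⟨i, by omega⟩
  have h2 : ∀ j : Fin N → ℕ, (∃ i, K ≤ j i) →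
      F.coeff (fun i => (e + Pi.single a 1 : Fin N → ℤ) i - j i) = 0 :=
    fun j ⟨i, hi⟩ => hM' j ⟨i, by omega⟩
  have hprod : ∀ (h : Fin N → ℂ), ∏ i, h i = h a * ∏ i ∈ Finset.univ.erase a, h i := fun h =>
    (Finset.mul_prod_erase _ _ (Finset.mem_univ a)).symm
  have herase : ∀ j : Fin N → ℕ,
      ∏ i ∈ Finset.univ.erase a,
        ((Ring.choose ((j i : ℤ) - (e + Pi.single a 1 : Fin N → ℤ) i) (j i) : ℤ) : ℂ) =
      ∏ i ∈ Finset.univ.erase a, ((Ring.choose ((j i : ℤ) - e i) (j i) : ℤ) : ℂ) := fun j =>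
    Finset.prod_congr rfl fun i hi => by simp [Finset.ne_of_mem_erase hi]
  set L : (Fin N → ℕ) → ℂ[X] := fun j =>
    C ((xVar a * F).coeff (fun i => e i - j i) *
        ∏ i, ((Ring.choose ((j i : ℤ) - e i) (j i) : ℤ) : ℂ)) * X ^ (∑ i, j i) -
      C (F.coeff (fun i => (e + Pi.single a 1 : Fin N → ℤ) i - j i) *
        ∏ i, ((Ring.choose ((j i : ℤ) - (e + Pi.single a 1 : Fin N → ℤ) i) (j i) : ℤ) : ℂ)) *
          X ^ (∑ i, j i) with hL
  set T : (Fin N → ℕ) → ℂ[X] := fun j => (X : ℂ[X]) • (C (F.coeff (fun i => e i - j i) *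
    ∏ i, ((Ring.choose ((j i : ℤ) - e i) (j i) : ℤ) : ℂ)) * X ^ (∑ i, j i)) with hT
  -- `L` and `T` are the terms to compare; the index `j` of `T` corresponds to `j + ε_a` in `L`
  have hL0 : ∀ j, j a = 0 → L j = 0 := fun j hj => by
    simp only [hL, hF, hprod, herase, hj, Ring.choose_zero_right, sub_self]
  have hLT : ∀ j, L (Function.update j a (j a + 1)) = T j := fun j => by
    have h3 : ∏ i ∈ Finset.univ.erase a,
        ((Ring.choose ((Function.update j a (j a + 1) i : ℕ) - e i)
          (Function.update j a (j a + 1) i) : ℤ) : ℂ) =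
        ∏ i ∈ Finset.univ.erase a, ((Ring.choose ((j i : ℤ) - e i) (j i) : ℤ) : ℂ) :=
      Finset.prod_congr rfl fun i hi => by
        rw [Function.update_of_ne (Finset.ne_of_mem_erase hi)]
    have h4 : ∑ i, Function.update j a (j a + 1) i = ∑ i, j i + 1 := by
      rw [Finset.sum_update_of_mem (Finset.mem_univ a),
        ← Finset.add_sum_erase _ _ (Finset.mem_univ a), Finset.sdiff_singleton_eq_erase]
      ring
    have h5 : (fun i => (e + Pi.single a 1 : Fin N → ℤ) i - (Function.update j a (j a + 1) i : ℕ)) =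
        fun i => e i - j i := by
      funext i
      by_cases hi : i = a
      · subst hi
        simp
      · simp [hi]
    have h6 : ((j a + 1 : ℕ) : ℤ) - e a = (j a - e a) + 1 := by push_cast; ring
    have h7 : ((j a + 1 : ℕ) : ℤ) - (e + Pi.single a 1 : Fin N → ℤ) a = j a - e a := by
      simp
    simp only [hL, hT, hF, hprod, herase, h3, h4, h5, Function.update_self, h6, h7,
      Ring.choose_succ_succ, smul_eq_mul]
    push_cast
    simp only [C_mul, C_add]
    ring
  rw [HahnSeries.coeff_add, coeff_constInU_xVar_mul, HahnSeries.C_mul_eq_smul,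
    HahnSeries.coeff_smul, coeff_shift (M := K) fun j hj => (hF j).trans (h2 j hj),
    coeff_shift h2, coeff_shift h1, ← sub_eq_iff_eq_add', ← Finset.sum_sub_distrib,
    Finset.smul_sum]
  symm
  refine Finset.sum_bij_ne_zero (fun j _ _ => Function.update j a (j a + 1)) ?_ ?_ ?_ ?_
  · intro j hj hne
    rw [Fintype.mem_piFinset] at hj ⊢
    intro i
    by_cases hi : i = a
    · subst hi
      rw [Function.update_self, Finset.mem_range]
      by_contra h
      refine hne ?_
      rw [hM j ⟨i, by omega⟩, zero_mul, C_0, zero_mul, smul_zero]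
    · rw [Function.update_of_ne hi]
      exact hj i
  · intro j _ _ k _ _ h
    funext i
    have h3 := congrFun h i
    by_cases hi : i = a
    · subst hi
      simpa using h3
    · simpa [hi] using h3
  · intro j hj hne
    have hja : j a ≠ 0 := fun h => hne (hL0 j h)
    have hj2 : Function.update (Function.update j a (j a - 1)) a
        (Function.update j a (j a - 1) a + 1) = j := by
      funext i
      by_cases hi : i = a
      · subst hi
        simp only [Function.update_self]
        omega
      · simp [hi]
    refine ⟨Function.update j a (j a - 1), ?_, ?_, hj2⟩
    · rw [Fintype.mem_piFinset] at hj ⊢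
      intro i
      have h3 := Finset.mem_range.1 (hj i)
      rw [Finset.mem_range]
      by_cases hi : i = a
      · subst hi
        rw [Function.update_self]
        omega
      · rwa [Function.update_of_ne hi]
    · have h3 := hLT (Function.update j a (j a - 1))
      rw [hj2] at h3
      exact h3.symm.trans_ne hne
  · intro j _ _
    exact (hLT j).symm

/-- Multiplication by `D` commutes with the shift, and `D` is not a zero divisor. -/
structure ShiftInvariantRegular (D : MultiLaurent N ℂ) : Prop where
  shift_mul : ∀ F, shift (D * F) = constInU D * shift F
  eq_zero_of_mul : ∀ G : MultiLaurent N ℂ[X], constInU D * G = 0 → G = 0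

theorem ShiftInvariantRegular.one : ShiftInvariantRegular (1 : MultiLaurent N ℂ) :=
  ⟨fun F => by rw [constInU_one, one_mul, one_mul], fun G hG => by
    rwa [constInU_one, one_mul] at hG⟩

theorem ShiftInvariantRegular.mul {D E : MultiLaurent N ℂ} (hD : ShiftInvariantRegular D)
    (hE : ShiftInvariantRegular E) : ShiftInvariantRegular (D * E) :=
  ⟨fun F => by rw [mul_assoc, hD.shift_mul, hE.shift_mul, constInU_mul, mul_assoc],
    fun G hG => hE.eq_zero_of_mul _ (hD.eq_zero_of_mul _ (by
      rwa [constInU_mul, mul_assoc] at hG))⟩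

theorem constInU_zero : constInU (0 : MultiLaurent N ℂ) = 0 := by
  rw [← sub_self (0 : MultiLaurent N ℂ), constInU_sub, sub_self]

theorem shift_zero : shift (0 : MultiLaurent N ℂ) = 0 := by
  rw [← sub_self (0 : MultiLaurent N ℂ), shift_sub, sub_self]

theorem ShiftInvariantRegular.neg {D : MultiLaurent N ℂ} (hD : ShiftInvariantRegular D) :
    ShiftInvariantRegular (-D) := by
  rw [← zero_sub]
  refine ⟨fun F => ?_, fun G hG => hD.eq_zero_of_mul G ?_⟩
  · rw [sub_mul, zero_mul, shift_sub, shift_zero, hD.shift_mul, constInU_sub, constInU_zero,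
      sub_mul, zero_mul]
  · rwa [constInU_sub, constInU_zero, sub_mul, zero_mul, zero_sub, neg_eq_zero] at hG

theorem ShiftInvariantRegular.xVar_sub {a b : Fin N} (hab : a ≠ b) :
    ShiftInvariantRegular (xVar a - xVar b) := by
  refine ⟨fun F => ?_, fun g h => ?_⟩
  · rw [sub_mul, shift_sub, shift_xVar_mul, shift_xVar_mul, add_sub_add_right_eq_sub, constInU_sub,
      sub_mul]
  · have hs : ∀ m : Fin N → ℤ, g.coeff (m + Pi.single a 1) = g.coeff (m + Pi.single b 1) := by
      intro m
      have := congrArg (fun q => HahnSeries.coeff q m) h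
      simpa [constInU_sub, sub_mul, coeff_constInU_xVar_mul, sub_eq_zero] using this
    by_contra hg
    obtain ⟨m, hm⟩ : ∃ m, g.coeff m ≠ 0 := by
      by_contra! h0
      exact hg (HahnSeries.ext (funext h0))
    have hk : ∀ k : ℕ, g.coeff (m + k • (Pi.single b 1 - Pi.single a 1)) ≠ 0 := by
      intro k
      induction k with
      | zero => simpa using hm
      | succ k ih =>
        have := hs (m + k • (Pi.single b 1 - Pi.single a 1) - Pi.single a 1)
        rw [sub_add_cancel] at this
        rw [this] at ih
        convert ih using 2
        rw [succ_nsmul]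
        abel
    -- the exponents `m + k (ε_b - ε_a)` decrease without bound in the coordinate `a`
    obtain ⟨c, hc⟩ := bddBelow_support g
    have := hc _ (hk (m a - c a + 1).toNat) a
    simp [hab] at this
    omega

/-- The Vandermonde product `∏_{i < l} (x_l - x_i)`. -/
noncomputable def vandermondeProd (N : ℕ) : MultiLaurent N ℂ :=
  ∏ l : Fin N, ∏ i ∈ Finset.Iio l, (xVar l - xVar i)

theorem shiftInvariantRegular_vandermondeProd : ShiftInvariantRegular (vandermondeProd N) := by
  refine Finset.prod_induction _ _ (fun _ _ => ShiftInvariantRegular.mul)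
    ShiftInvariantRegular.one fun l _ => ?_
  refine Finset.prod_induction _ _ (fun _ _ => ShiftInvariantRegular.mul)
    ShiftInvariantRegular.one fun i hi => ?_
  exact ShiftInvariantRegular.xVar_sub (Finset.mem_Iio.1 hi).ne'

end Vandermonde

/-! ### Uniform bounds for the exponents of the quotients -/

section Bounds

variable {N : ℕ}

theorem alternant_eq_det_dd_mul (f : Fin N → LaurentSeries ℂ) :
    alternant f =
      (Matrix.of fun i l : Fin N => dd (f i) (Finset.Iic l)).det * vandermondeProd N := by
  have h : (Matrix.of fun i j => atVar j (f i)) =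
      (Matrix.of fun i l : Fin N => dd (f i) (Finset.Iic l)) *
        Matrix.of fun l j : Fin N => ∏ i ∈ Finset.Iio l, (xVar j - xVar i) := by
    ext1 i j
    rw [Matrix.mul_apply, Matrix.of_apply, newton]
    rfl
  rw [alternant, h, Matrix.det_mul]
  congr 1
  rw [Matrix.det_of_isUpperTriangular]
  · rfl
  · intro l j hlj
    exact Finset.prod_eq_zero (i := j) (by simpa using hlj) (sub_self _)

/-- The common denominator of `s_λ` and `s*_λ`: the determinant `det (x_j ^ (N - i))`, which is the
Vandermonde product up to the sign of the reversal of the rows. -/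
noncomputable def schurDenominator (N : ℕ) : MultiLaurent N ℂ :=
  ((Equiv.Perm.sign (Fin.revPerm : Equiv.Perm (Fin N)) : ℤ) : MultiLaurent N ℂ) *
    vandermondeProd N

/-- The alternant of monic polynomials of degrees `N - 1, …, 0` depends on `N` only. -/
theorem alternant_ofPoly_eq (q : ℕ → ℂ[X]) (hd : ∀ n, (q n).natDegree = n)
    (hm : ∀ n, (q n).Monic) (g : Fin N → LaurentSeries ℂ)
    (hg : ∀ i, g i = NormalizedDeltaOperator.ofPoly (q (Fin.rev i))) :
    alternant g = schurDenominator N := by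
  have hev : ∀ (j : Fin N) (r : ℂ[X]), atVar j (NormalizedDeltaOperator.ofPoly r) =
      (r.map (HahnSeries.C : ℂ →+* MultiLaurent N ℂ)).eval (xVar j) := by
    intro j r
    rw [eval_map, NormalizedDeltaOperator.ofPoly, coe_eval₂RingHom, hom_eval₂, atVar_X]
    congr 1
    ext1 c
    exact HahnSeries.embDomainRingHom_C
  have hN := Matrix.det_eval_matrixOfPolynomials_eq_det_vandermonde (fun j : Fin N => xVar j)
    (fun i => (q i).map HahnSeries.C) (fun i => by rw [(hm i).natDegree_map, hd])
    (fun i => (hm i).map _)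
  have hv : (Matrix.vandermonde fun j : Fin N => xVar j).det = vandermondeProd N := by
    rw [Matrix.det_vandermonde]
    exact Finset.prod_comm' (by simp)
  rw [schurDenominator, ← hv, hN, ← Matrix.det_transpose, ← Matrix.det_permute, alternant]
  congr 1
  ext1 i j
  simp [hg, hev]

/-- In each term of `F`, every exponent is at least `b` and the sum of the exponents is at least
`d` (exponents of the `x_i⁻¹`). -/
def ExponentsGE (F : MultiLaurent N ℂ) (b d : ℤ) : Prop :=
  ∀ e, F.coeff e ≠ 0 → (∀ i, b ≤ e i) ∧ d ≤ ∑ i, e i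

theorem ExponentsGE.mul {F G : MultiLaurent N ℂ} {b c d d' : ℤ} (hF : ExponentsGE F b d)
    (hG : ExponentsGE G c d') : ExponentsGE (F * G) (b + c) (d + d') := by
  intro e he
  rw [HahnSeries.coeff_mul] at he
  obtain ⟨⟨x, y⟩, hxy, hne⟩ := Finset.exists_ne_zero_of_sum_ne_zero he
  simp only [Finset.mem_antidiagonal] at hxy
  have h1 := hF x (left_ne_zero_of_mul hne)
  have h2 := hG y (right_ne_zero_of_mul hne)
  rw [← hxy.2.2]
  refine ⟨fun i => add_le_add (h1.1 i) (h2.1 i), ?_⟩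
  simp only [Pi.add_apply, Finset.sum_add_distrib]
  exact add_le_add h1.2 h2.2

theorem ExponentsGE.prod {ι : Type*} (S : Finset ι) (F : ι → MultiLaurent N ℂ) (b d : ι → ℤ)
    (h : ∀ i ∈ S, ExponentsGE (F i) (b i) (d i)) :
    ExponentsGE (∏ i ∈ S, F i) (∑ i ∈ S, b i) (∑ i ∈ S, d i) := by
  classical
  induction S using Finset.induction_on with
  | empty =>
    intro e he
    rw [Finset.prod_empty, HahnSeries.coeff_one] at he
    have h0 : e = 0 := by
      by_contra h0
      exact he (if_neg h0)
    simp [h0]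
  | insert j S hj ih =>
    rw [Finset.prod_insert hj, Finset.sum_insert hj, Finset.sum_insert hj]
    exact (h j (Finset.mem_insert_self _ _)).mul
      (ih fun i hi => h i (Finset.mem_insert_of_mem hi))

theorem ExponentsGE.det {M : Matrix (Fin N) (Fin N) (MultiLaurent N ℂ)} (b d : Fin N → ℤ)
    (h : ∀ i j, ExponentsGE (M i j) (b i) (d i)) :
    ExponentsGE M.det (∑ i, b i) (∑ i, d i) := by
  intro e he
  rw [Matrix.det_apply, HahnSeries.coeff_sum] at he
  obtain ⟨σ, -, hσ⟩ := Finset.exists_ne_zero_of_sum_ne_zero he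
  have hne : (∏ i, M (σ i) i).coeff e ≠ 0 := by
    rcases Int.units_eq_one_or (Equiv.Perm.sign σ) with hs | hs <;> rw [hs] at hσ
    · simpa using hσ
    · simpa using hσ
  have := ExponentsGE.prod Finset.univ (fun i => M (σ i) i) (fun i => b (σ i)) (fun i => d (σ i))
    (fun i _ => h _ _) e hne
  rwa [Equiv.sum_comp σ b, Equiv.sum_comp σ d] at this

theorem exponentsGE_dd {f : LaurentSeries ℂ} {n n' : ℤ} (hf : ∀ e, n + e < 0 → f.coeff e = 0)
    (hn : n ≤ n') (S : Finset (Fin N)) : ExponentsGE (dd f S) (-|n'| - 1) (-n - 1) := by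
  intro m hm
  have habs := le_abs_self n'
  have habs0 := abs_nonneg n'
  change ddCoeff f S m ≠ 0 at hm
  rw [ddCoeff] at hm
  have key : f.coeff (∑ i, m i - S.card + 1) ≠ 0 → -n - 1 ≤ ∑ i, m i := fun h => by
    by_contra hc
    exact h (hf _ (by omega))
  split_ifs at hm with h1 h2 h3
  · refine ⟨fun i => ?_, key hm⟩
    have hle : ∀ i, m i ≤ 0 := fun i => by
      by_cases hi : i ∈ S
      · exact h2 i hi
      · exact (h1 i hi).le
    have h5 : ∑ i, m i ≤ m i := by
      rw [← Finset.add_sum_erase _ _ (Finset.mem_univ i)]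
      have : ∑ j ∈ Finset.univ.erase i, m j ≤ 0 := Finset.sum_nonpos fun j _ => hle j
      omega
    have := key hm
    omega
  · refine ⟨fun i => ?_, key (right_ne_zero_of_mul hm)⟩
    have : 0 ≤ m i := by
      by_cases hi : i ∈ S
      · have := h3 i hi; omega
      · exact (h1 i hi).ge
    omega
  · exact absurd rfl hm
  · exact absurd rfl hm

theorem constInU_injective : Function.Injective (constInU (N := N)) := by
  intro F G h
  ext1
  funext e
  exact C_injective (congrArg (fun s => HahnSeries.coeff s e) h)

theorem sign_rev_eq : ((Equiv.Perm.sign (Fin.revPerm : Equiv.Perm (Fin N)) : ℤ) :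
      MultiLaurent N ℂ) = 1 ∨
    ((Equiv.Perm.sign (Fin.revPerm : Equiv.Perm (Fin N)) : ℤ) : MultiLaurent N ℂ) = -1 := by
  rcases Int.units_eq_one_or (Equiv.Perm.sign (Fin.revPerm : Equiv.Perm (Fin N))) with h | h <;>
    rw [h] <;> simp

theorem shiftInvariantRegular_schurDenominator :
    ShiftInvariantRegular (schurDenominator N) := by
  rcases sign_rev_eq (N := N) with hs | hs <;> rw [schurDenominator, hs]
  · exact ShiftInvariantRegular.one.mul shiftInvariantRegular_vandermondeProd
  · exact ShiftInvariantRegular.one.neg.mul shiftInvariantRegular_vandermondeProd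

/-- The quotient of `det (g_{μ_i + N - i}(x_j))` by `det (x_j ^ (N - i))` has exponents bounded in
terms of `λ`, for `μ ≤ λ`, and the total degree of its terms is bounded in terms of `|μ|`: up to the
sign it is a determinant of divided differences. -/
theorem exponentsGE_quotient {g : ℤ → LaurentSeries ℂ}
    (hg : ∀ n e : ℤ, n + e < 0 → (g n).coeff e = 0) {lam mu : Fin N → ℤ} (hle : mu ≤ lam)
    {T : MultiLaurent N ℂ} (hT : (alternant fun i => g (shiftedParts mu i)) =
      schurDenominator N * T) :
    ExponentsGE T (∑ i, (-|shiftedParts lam i| - 1)) (∑ i, (-shiftedParts mu i - 1)) := by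
  set M := Matrix.of fun i l : Fin N => dd (g (shiftedParts mu i)) (Finset.Iic l) with hM
  have hdet : ExponentsGE M.det (∑ i, (-|shiftedParts lam i| - 1))
      (∑ i, (-shiftedParts mu i - 1)) :=
    ExponentsGE.det _ _ fun i j => exponentsGE_dd (hg _) (by
      have : mu i ≤ lam i := hle i
      simp only [shiftedParts]
      omega) _
  have hreg : ∀ F : MultiLaurent N ℂ, vandermondeProd N * F = 0 → F = 0 := fun F hF => by
    refine constInU_injective ?_
    rw [constInU_zero]
    refine shiftInvariantRegular_vandermondeProd.eq_zero_of_mul _ ?_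
    rw [← constInU_mul, hF, constInU_zero]
  have h1 : ((Equiv.Perm.sign (Fin.revPerm : Equiv.Perm (Fin N)) : ℤ) : MultiLaurent N ℂ) * T =
      M.det := by
    rw [← sub_eq_zero]
    refine hreg _ ?_
    rw [alternant_eq_det_dd_mul, schurDenominator] at hT
    linear_combination -hT
  rw [← h1] at hdet
  rcases sign_rev_eq (N := N) with hs | hs <;> rw [hs] at hdet
  · rwa [one_mul] at hdet
  · intro e he
    refine hdet e ?_
    have h2 : -1 * T = 0 - T := by ring
    rw [h2, HahnSeries.coeff_sub, HahnSeries.coeff_zero, zero_sub]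
    exact neg_ne_zero.2 he

theorem finite_setOf_le_sum_ge (lam : Fin N → ℤ) (c : ℤ) :
    {mu : Fin N → ℤ | mu ≤ lam ∧ c ≤ ∑ i, mu i}.Finite := by
  refine (Set.finite_Icc (fun i => c - ∑ j ∈ Finset.univ.erase i, lam j) lam).subset ?_
  rintro mu ⟨h1, h2⟩
  refine ⟨fun i => ?_, h1⟩
  rw [← Finset.add_sum_erase _ _ (Finset.mem_univ i)] at h2
  have := Finset.sum_le_sum fun j (_ : j ∈ Finset.univ.erase i) => h1 j
  simp only
  omega

/-- The formal expansion of the quotients by the Vandermonde determinant: the expansion of the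
numerators may be divided, as the Vandermonde determinant is invariant under the shift and not a
zero divisor, and as the quotients form a summable family. -/
theorem BinomialShift.hasFormalSum {f g : ℤ → LaurentSeries ℂ} {q : ℕ → ℂ[X]}
    (H : BinomialShift f g q) {lam : Fin N → ℤ} (hlam : Antitone lam) {S : MultiLaurent N ℂ}
    {T : (Fin N → ℤ) → MultiLaurent N ℂ}
    (hS : (alternant fun i => f (shiftedParts lam i)) =
      schurDenominator N * S)
    (hT : ∀ mu, (alternant fun i => g (shiftedParts mu i)) =
      schurDenominator N * T mu) :
    HasFormalSum (fun mu : {mu : Fin N → ℤ // Antitone mu ∧ mu ≤ lam} =>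
      HahnSeries.C (shiftDet q lam mu) * constInU (T mu)) (shift S) := by
  have hcoeff : ∀ (a : ℂ[X]) (F : MultiLaurent N ℂ) (e : Fin N → ℤ),
      (HahnSeries.C a * constInU F).coeff e = a * C (F.coeff e) := fun a F e => by
    rw [HahnSeries.C_mul_eq_smul, HahnSeries.coeff_smul]
    rfl
  have hne : ∀ (a : ℂ[X]) (F : MultiLaurent N ℂ) (e : Fin N → ℤ),
      (HahnSeries.C a * constInU F).coeff e ≠ 0 → F.coeff e ≠ 0 := fun a F e h h0 =>
    h (by rw [hcoeff, h0, C_0, mul_zero])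
  let fam : HahnSeries.SummableFamily (Fin N → ℤ) ℂ[X]
      {mu : Fin N → ℤ // Antitone mu ∧ mu ≤ lam} :=
    { toFun := fun mu => HahnSeries.C (shiftDet q lam mu) * constInU (T mu)
      isPWO_iUnion_support' := by
        refine isPWO_of_bddBelow ⟨fun _ => ∑ i, (-|shiftedParts lam i| - 1), ?_⟩
        intro e he
        obtain ⟨mu, hmu⟩ := Set.mem_iUnion.1 he
        exact (exponentsGE_quotient H.coeff_eq_zero mu.2.2 (hT mu) e (hne _ _ _ hmu)).1
      finite_co_support' := by
        intro e
        refine Set.Finite.subset (((finite_setOf_le_sum_ge lam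
          (-∑ i, e i - ∑ i : Fin N, ((N : ℤ) - (i + 1) + 1))).preimage
            Subtype.val_injective.injOn)) ?_
        intro mu hmu
        have h1 := (exponentsGE_quotient H.coeff_eq_zero mu.2.2 (hT mu) e (hne _ _ _ hmu)).2
        refine ⟨mu.2.2, ?_⟩
        have h2 : ∑ i, (-shiftedParts mu.1 i - 1) =
            -∑ i, mu.1 i - ∑ i : Fin N, ((N : ℤ) - (i + 1) + 1) := by
          rw [← Finset.sum_neg_distrib, ← Finset.sum_sub_distrib]
          refine Finset.sum_congr rfl fun i _ => ?_
          simp only [shiftedParts]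
          ring
        rw [h2] at h1
        linarith }
  refine ⟨fam, fun _ => rfl, ?_⟩
  rw [← sub_eq_zero]
  refine shiftInvariantRegular_schurDenominator.eq_zero_of_mul _ ?_
  rw [mul_sub, sub_eq_zero, ← shiftInvariantRegular_schurDenominator.shift_mul, ← hS,
    ← HahnSeries.SummableFamily.hsum_smul]
  ext1
  funext e
  rw [H.coeff_shift_alternant hlam, HahnSeries.SummableFamily.coeff_hsum]
  refine finsum_congr fun mu => ?_
  rw [HahnSeries.SummableFamily.smul_apply, hT, ← hcoeff, constInU_mul (schurDenominator N)]
  refine congrArg (fun s => HahnSeries.coeff s e) ?_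
  change constInU (schurDenominator N) * (HahnSeries.C (shiftDet q lam mu) * constInU (T mu)) = _
  exact mul_left_comm _ _ _

end Bounds

namespace NormalizedDeltaOperator

variable (Q : NormalizedDeltaOperator) {N : ℕ}

theorem schurNum_zero_eq : Q.schurNum (0 : Fin N → ℤ) =
    schurDenominator N := by
  refine alternant_ofPoly_eq Q.basicPoly (fun n => (Q.basicPoly_spec n).1)
    (fun n => (Q.basicPoly_spec n).2) _ fun i => ?_
  rw [← p_natCast]
  congr 1
  rw [Fin.val_rev, Nat.cast_sub (by omega)]
  simp

theorem schurStarNum_zero_eq : Q.schurStarNum (0 : Fin N → ℤ) =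
    schurDenominator N := by
  refine alternant_ofPoly_eq Q.basicPolyStar (fun n => (Q.basicPolyStar_spec n).1)
    (fun n => (Q.basicPolyStar_spec n).2) _ fun i => ?_
  rw [← pStar_natCast]
  congr 1
  rw [Fin.val_rev, Nat.cast_sub (by omega)]
  simp

end NormalizedDeltaOperator

end SchurType

open SchurType in
theorem theorem3p1 (Q : NormalizedDeltaOperator) (N : ℕ) (lam : Fin N → ℤ) (hlam : Antitone lam) :
    HasFormalSum
      (fun mu : {mu : Fin N → ℤ // Antitone mu ∧ mu ≤ lam} =>
        HahnSeries.C (Q.d lam mu) * constInU (Q.schur mu))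
      (shift (Q.schur lam)) ∧
    HasFormalSum
      (fun mu : {mu : Fin N → ℤ // Antitone mu ∧ mu ≤ lam} =>
        HahnSeries.C (Q.d lam mu) * constInU (Q.schurStar mu))
      (shift (Q.schurStar lam)) ∧
    HasFormalSum
      (fun mu : {mu : Fin N → ℤ // Antitone mu ∧ mu ≤ lam} =>
        HahnSeries.C (Q.dStar lam mu) * constInU (Q.schur mu))
      (shift (Q.schurStar lam)) := by
  have h : ∀ mu : Fin N → ℤ, (alternant fun i => Q.p (shiftedParts mu i)) =
      schurDenominator N * Q.schur mu := fun mu => by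
    rw [← Q.schurNum_zero_eq, ← Q.schur_spec]
    rfl
  have hStar : ∀ mu : Fin N → ℤ, (alternant fun i => Q.pStar (shiftedParts mu i)) =
      schurDenominator N * Q.schurStar mu := fun mu => by
    rw [← Q.schurStarNum_zero_eq, ← Q.schurStar_spec]
    rfl
  exact ⟨Q.binomialShift_p.hasFormalSum hlam (h lam) h,
    Q.binomialShift_pStar.hasFormalSum hlam (hStar lam) hStar,
    Q.binomialShift_pStar_p.hasFormalSum hlam (hStar lam) h⟩
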